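/- **Setting.** Let $\mathbb X,\mathbb Y$ be standard Borel spaces, $\mathcal J$ a probability measure on $\mathbb X$, $\psi$ a $\sigma$-finite measure on $\mathbb Y$, and $q_{ji}\in[0,1]$. In the Bayesian changepoint model, $C_i\in\{0,\dots,i\}$ is the most recent changepoint at or before time $i$ and $X_i\in\mathbb X$ is the segment height: $(C_i,X_i)_{i\ge 0}$ is a Markov chain with $C_0=0$, $X_0\sim\mathcal J$, such that, given $(C_{i-1},X_{i-1})=(j,x)$, one has $(C_i,X_i)=(j,x)$ with probability $q_{ji}$, while with probability $1-q_{ji}$ one has $C_i=i$ and $X_i\sim\mathcal J$ is newly drawn. Given the heights, the observations $Y_1,\dots,Y_n$ are independent and $Y_i$ has density $p_i(\cdot\mid X_i)$ with respect to $\psi$. Fix data $y_{1:n}$ with $0<\int\prod_{\ell=j}^{i}p_\ell(y_\ell\mid x)\,\mathcal J(dx)<\infty$ for $0<j\le i\le n$. Conditional laws given $Y_{1:i}=y_{1:i}$ are those given by the Bayes formula. Put $\tilde c_{ji}=P(C_i=j\mid C_{i+1}=i+1,\,Y_{1:i}=y_{1:i})$ for $0<i<n$, $0\le j\le i$ (read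 as $0$ if $C_{i+1}=i+1$ has conditional probability $0$ given $Y_{1:i}=y_{1:i}$), and $\tilde c_{jn}=P(C_n=j\mid Y_{1:n}=y_{1:n})$. Let $\mathcal H_{ji}$ be the law of $X_i$ given $C_i=j$, $Y_{1:i}=y_{1:i}$, and, for measurable $f:\mathbb X\to\mathbb R^u$, let $\mathcal H^f_{ji}=\int f\,d\mathcal H_{ji}$. **Sparse representations.** A sparse representation of size $N$ is a read-only list, ordered by $i$, of $N$ distinct existing particles $(j,i)$ with $0\le j\le i$, $0<i\le n$, each carrying a real weight $w_{ji}$ and, where needed, a vector $h_{ji}\in\mathbb R^u$; missing particles have weight $0$. Assume $1\le n\le N$. It is *exact* if $w_{ji}=\tilde c_{ji}$ for existing particles and $\tilde c_{ji}=0$ for missing ones. It is *normalized* if $\sum_{j=0}^i w_{ji}=1$ for each $1\le i\le n$, as for pruned backward quantities, which are computed from the existing particles only. A normalized representation assigns to each set $\{\tau_1<\dots<\tau_k\}\subseteq\{1,\dots,n\}$ of changepoints the weight $w_{0,\tau_1-1}\big(\prod_{m=1}^{k-1}w_{\tau_m,\tau_{m+1}-1}\big)w_{\tau_k,n}$ (with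 $w_{00}=1$, and $w_{0n}$ for the empty set); these weights sum to one. **Machine.** Time is the number of steps and space the number of accessed working-memory cells (the input not counted) of a random access machine with unit-cost exact real arithmetic $+,-,\times$, real memory cells, and finitely many index registers, which can be reset, copied, incremented, decremented, compared and loaded from the input. **Theorem.** 1. There are one program and one constant $K$ such that on every sparse representation with $1\le n\le N$ the program halts after at most $KN$ steps, uses at most $Kn$ cells of space, and outputs numbers $Q_1,\dots,Q_n$ with the following properties. If the representation is exact for some model and data as above, then $Q_i=\tilde q_i=P(C_i=i\mid Y_{1:n}=y_{1:n})$ for all $1\le i\le n$. If the representation is normalized, then $Q_i$ is the total weight of the sets of changepoints that contain $i$, for all $1\le i\le n$. 2. For every $u$ there are one program and one constant $K$ such that on every sparse representation with vectors $h_{ji}\in\mathbb R^u$ and $1\le n\le N$ the program halts after at most $KN$ steps, uses at most $Kn$ cells of space, and outputs vectors $E_1,\dots,E_n\in\mathbb R^u$ with the following properties. If the representation is exact for some model and data as above and, for a measurable $f:\mathbb X\to\mathbb R^u$, every existing particle with $w_{ji}\ne0$ has $f$ integrable with respect to $\mathcal H_{ji}$ and $h_{ji}=\mathcal H^f_{ji}$,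 then for all $1\le i\le n$ the conditional expectation $E[f(X_i)\mid Y_{1:n}=y_{1:n}]$ exists and equals $E_i$. If the representation is normalized, then, for all $1\le i\le n$, $E_i$ is the sum over all sets of changepoints of their weight times the vector of the segment that contains $i$ (that is, $h_{ab}$ if this segment is $\{a,\dots,b\}$; for the initial segment, before the first changepoint, $a=0$; a missing particle contributes $0$). -/

import Mathlib

open MeasureTheory ProbabilityTheory
open scoped ENNReal NNReal

/-! ## The Bayesian changepoint model -/

/-- The data of a changepoint model with segment heights in `𝕏` and observations in `𝕐`.
* `stay j i` is the probability `q_{ji} = P(C_i = j | C_{i-1} = j)`, used for `j < i`;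
* `J` is the distribution of the height of a new segment;
* `dens i x` is the density, with respect to the sigma-finite measure `ψ`, of the observation `Y_i`
  given `X_i = x`. -/
structure ChangepointModel (𝕏 𝕐 : Type*) [MeasurableSpace 𝕏] [MeasurableSpace 𝕐] where
  stay : ℕ → ℕ → unitInterval
  J : Measure 𝕏
  isProbabilityMeasure_J : IsProbabilityMeasure J
  ψ : Measure 𝕐
  sigmaFinite_ψ : SigmaFinite ψ
  dens : ℕ → 𝕏 → 𝕐 → ℝ≥0
  measurable_dens : ∀ i, Measurable (Function.uncurry (dens i))
  lintegral_dens : ∀ i x, ∫⁻ y, (dens i x y : ℝ≥0∞) ∂ψ = 1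

namespace ChangepointModel

variable {𝕏 𝕐 : Type*} [MeasurableSpace 𝕏] [MeasurableSpace 𝕐] (M : ChangepointModel 𝕏 𝕐)

/-- The law of `(C_i, X_i)` given `(C_{i-1}, X_{i-1}) = s`: with probability `q_{ji}`, where `j` is
the current value of `C`, nothing changes; otherwise `C_i = i` and a new height is drawn. -/
noncomputable def stepLaw (i : ℕ) (s : ℕ × 𝕏) : Measure (ℕ × 𝕏) :=
  ENNReal.ofReal (M.stay s.1 i) • Measure.dirac s
    + ENNReal.ofReal (1 - M.stay s.1 i) • M.J.map (fun x => (i, x))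

theorem measurable_stepLaw (i : ℕ) : Measurable (M.stepLaw i) := by
  refine Measure.measurable_of_measurable_coe _ fun A hA => ?_
  have h1 : Measurable fun s : ℕ × 𝕏 => ENNReal.ofReal (M.stay s.1 i) :=
    (measurable_of_countable fun j : ℕ => ENNReal.ofReal (M.stay j i)).comp measurable_fst
  have h2 : Measurable fun s : ℕ × 𝕏 => ENNReal.ofReal (1 - M.stay s.1 i) :=
    (measurable_of_countable fun j : ℕ => ENNReal.ofReal (1 - M.stay j i)).comp measurable_fst
  have h3 : Measurable fun s : ℕ × 𝕏 => Measure.dirac s A :=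
    (Measure.measurable_coe hA).comp Measure.measurable_dirac
  simp only [stepLaw, Measure.add_apply, Measure.smul_apply, smul_eq_mul]
  exact (h1.mul h3).add (h2.mul measurable_const)

/-- The transition kernel of the Markov chain `(C_i, X_i)` from time `i - 1` to time `i`. -/
noncomputable def stepKernel (i : ℕ) : Kernel (ℕ × 𝕏) (ℕ × 𝕏) where
  toFun := M.stepLaw i
  measurable' := M.measurable_stepLaw i

instance (i : ℕ) : IsMarkovKernel (M.stepKernel i) := by
  refine ⟨fun s => ⟨?_⟩⟩
  have := M.isProbabilityMeasure_J
  have hm : IsProbabilityMeasure (M.J.map (fun x => (i, x))) :=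
    Measure.isProbabilityMeasure_map measurable_prodMk_left.aemeasurable
  have h0 := (M.stay s.1 i).2.1
  have h1 := (M.stay s.1 i).2.2
  change M.stepLaw i s Set.univ = 1
  simp only [stepLaw, Measure.add_apply, Measure.smul_apply, smul_eq_mul, measure_univ, mul_one]
  rw [← ENNReal.ofReal_add h0 (by linarith)]
  simp

/-- The initial law: `C_0 = 0`, and the height of the segment that is running at the beginning
has law `J`. -/
noncomputable def initialLaw : Measure (ℕ × 𝕏) := M.J.map (fun x => (0, x))

instance : IsProbabilityMeasure M.initialLaw := by
  have := M.isProbabilityMeasure_J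
  exact Measure.isProbabilityMeasure_map measurable_prodMk_left.aemeasurable

/-- The transition kernels, as kernels that are allowed to look at the whole past. -/
noncomputable def historyKernel (i : ℕ) :
    Kernel (Π _ : Finset.Iic i, ℕ × 𝕏) (ℕ × 𝕏) :=
  (M.stepKernel (i + 1)).comap (fun h => h ⟨i, Finset.mem_Iic.2 le_rfl⟩) (measurable_pi_apply _)

instance (i : ℕ) : IsMarkovKernel (M.historyKernel i) := by
  unfold historyKernel; infer_instance

/-- The prior law of the trajectory `ω = (C_i, X_i)_{i ≥ 0}`: the law of the Markov chain with the
above initial law and transition kernels. Thus `(ω i).1 = C_i` and `(ω i).2 = X_i`. -/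
noncomputable def prior : Measure (ℕ → ℕ × 𝕏) :=
  Kernel.trajMeasure (X := fun _ => ℕ × 𝕏) M.initialLaw M.historyKernel

/-- The conditional density of `Y_{1:m}` at `y_{1:m}` given the trajectory `ω`. -/
noncomputable def likelihood (y : ℕ → 𝕐) (m : ℕ) (ω : ℕ → ℕ × 𝕏) : ℝ≥0∞ :=
  ∏ l ∈ Finset.Icc 1 m, (M.dens l (ω l).2 (y l) : ℝ≥0∞)

/-- The marginal density of `Y_{1:m}` at `y_{1:m}`. -/
noncomputable def evidence (y : ℕ → 𝕐) (m : ℕ) : ℝ≥0∞ :=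
  ∫⁻ ω, M.likelihood y m ω ∂M.prior

/-- The conditional law of the trajectory given `Y_{1:m} = y_{1:m}`, by the Bayes formula for
densities. -/
noncomputable def posterior (y : ℕ → 𝕐) (m : ℕ) : Measure (ℕ → ℕ × 𝕏) :=
  (M.evidence y m)⁻¹ • M.prior.withDensity (M.likelihood y m)

/-- The marginal likelihood `∫ ∏_{l=j}^i p(Y_l = y_l | X_l = x) J(dx)` of a segment. -/
noncomputable def segmentIntegral (y : ℕ → 𝕐) (j i : ℕ) : ℝ≥0∞ :=
  ∫⁻ x, ∏ l ∈ Finset.Icc j i, (M.dens l x (y l) : ℝ≥0∞) ∂M.J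

/-- The backward quantity
`P(C_i = j | C_{i+1} = i+1, Y_{1:i} = y_{1:i})` for `i < n` and
`P(C_n = j | Y_{1:n} = y_{1:n})` for `i = n`
(with value `0` if `i < n` and the event `C_{i+1} = i+1` is null). -/
noncomputable def backward (y : ℕ → 𝕐) (n j i : ℕ) : ℝ :=
  if i = n then (M.posterior y n).real {ω | (ω n).1 = j}
  else (cond (M.posterior y i) {ω | (ω (i + 1)).1 = i + 1}).real {ω | (ω i).1 = j}

/-- The law `H_{ji}` of `X_i` given `C_i = j` and `Y_{1:i} = y_{1:i}`. -/
noncomputable def heightLaw (y : ℕ → 𝕐) (j i : ℕ) : Measure 𝕏 :=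
  (cond (M.posterior y i) {ω | (ω i).1 = j}).map (fun ω => (ω i).2)

end ChangepointModel

/-! ## Sparse representations -/

/-- A sparse representation of an array indexed by `0 ≤ j ≤ i`, `0 < i ≤ n`: a list of `size`
existing particles. The `k`-th one is the particle `(row k, col k)` (that is, `j = row k` and
`i = col k`); it carries the real number `weight k` and `u` further real numbers `moment k`.
The list is ordered by columns, as the forward and backward recursions produce it;
the order within a column is arbitrary. -/
structure ParticleTable (u : ℕ) where
  n : ℕ
  size : ℕ
  row : Fin size → ℕ
  col : Fin size → ℕ
  weight : Fin size → ℝ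
  moment : Fin size → Fin u → ℝ
  row_le_col : ∀ k, row k ≤ col k
  col_pos : ∀ k, 0 < col k
  col_le : ∀ k, col k ≤ n
  col_mono : Monotone col
  injective : Function.Injective fun k => (row k, col k)

namespace ParticleTable

variable {u : ℕ} (T : ParticleTable u)

/-- The particle `(j, i)` exists. -/
def Present (j i : ℕ) : Prop := ∃ k, T.row k = j ∧ T.col k = i

/-- The represented array of weights; the weight of a particle that does not exist is `0`. -/
noncomputable def entry (j i : ℕ) : ℝ :=
  ∑ k, if T.row k = j ∧ T.col k = i then T.weight k else 0

/-- The represented array of the additional vectors; `0` for a particle that does not exist. -/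
noncomputable def momentEntry (j i : ℕ) : Fin u → ℝ :=
  ∑ k, if T.row k = j ∧ T.col k = i then T.moment k else 0

/-- In every column the weights sum to one: the existing `(j, i)`, `0 ≤ j ≤ i`, carry
a (conditional) distribution of the start `j` of a segment that ends in `i`. -/
def Normalized : Prop :=
  ∀ i ∈ Finset.Icc 1 T.n, ∑ j ∈ Finset.range (i + 1), T.entry j i = 1

/-- The most recent changepoint at or before `i`, if `τ` is the set of changepoints; `0` if there
is none. -/
def lastChangepoint (τ : Finset ℕ) (i : ℕ) : ℕ := (τ.filter (· ≤ i)).sup id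

/-- The right end of the segment that contains `i`, if `τ` is the set of changepoints. -/
noncomputable def segmentEnd (n : ℕ) (τ : Finset ℕ) (i : ℕ) : ℕ :=
  sInf {e | i ≤ e ∧ (e = n ∨ e + 1 ∈ τ)}

open Classical in
/-- The probability that a table assigns to the set `τ = {τ₁ < ... < τ_k} ⊆ {1, ..., n}` of
changepoints, namely the product of the weights of all its segments,
`c_{0, τ₁ - 1} c_{τ₁, τ₂ - 1} ⋯ c_{τ_k, n}` (where `c_{00} = 1`). -/
noncomputable def segmentationWeight (τ : Finset ℕ) : ℝ :=
  ∏ i ∈ (Finset.Icc 1 T.n).filter (fun i => i = T.n ∨ i + 1 ∈ τ), T.entry (lastChangepoint τ i) i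

/-- The probability of a changepoint at `i` under the law on segmentations given by the table. -/
noncomputable def changepointProb (i : ℕ) : ℝ :=
  ∑ τ ∈ (Finset.Icc 1 T.n).powerset.filter (fun τ => i ∈ τ), T.segmentationWeight τ

/-- The expectation, under the law on segmentations given by the table, of the vector attached
to the segment that contains `i`. -/
noncomputable def heightExpectation (i : ℕ) : Fin u → ℝ :=
  ∑ τ ∈ (Finset.Icc 1 T.n).powerset,
    T.segmentationWeight τ • T.momentEntry (lastChangepoint τ i) (segmentEnd T.n τ i)

variable {𝕏 𝕐 : Type*} [MeasurableSpace 𝕏] [MeasurableSpace 𝕐]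

/-- The table is a lossless representation of the backward quantities of the model `M` for
the observations `y`: existing particles have the right weight, and the backward quantity of a
particle that does not exist vanishes. -/
def Represents (M : ChangepointModel 𝕏 𝕐) (y : ℕ → 𝕐) : Prop :=
  (∀ k, T.weight k = M.backward y T.n (T.row k) (T.col k)) ∧
  ∀ i ∈ Finset.Icc 1 T.n, ∀ j ≤ i, ¬ T.Present j i → M.backward y T.n j i = 0

/-- The additional vectors are the segment integrals `H^f_{ji} = ∫ f dH_{ji}`, for all existing
particles (particles of weight `0` may carry anything, since `H_{ji}` can be a conditional law
given a null event there). -/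
def RepresentsMoments (M : ChangepointModel 𝕏 𝕐) (y : ℕ → 𝕐) (f : 𝕏 → Fin u → ℝ) : Prop :=
  ∀ k, T.weight k ≠ 0 → Integrable f (M.heightLaw y (T.row k) (T.col k)) ∧
    T.moment k = ∫ x, f x ∂M.heightLaw y (T.row k) (T.col k)

end ParticleTable

/-! ## The machine model

A random access machine over the real numbers with unit costs. The table is read-only and is
accessed particle by particle. Apart from this the machine has finitely many index registers
(natural numbers; they can only be reset, copied, incremented, decremented, compared and loaded
from the input, so that after `t` steps no register exceeds `max (n, size) + t`), finitely many
real registers, and a working memory of real cells, organised in arrays. -/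

/-- Elementary instructions. Registers and arrays are named by natural numbers; only index
registers can be used to address a cell of an array or a particle of the input. -/
inductive RamInstr where
  /-- `idx a := 0` -/
  | idxZero (a : ℕ)
  /-- `idx a := idx b` -/
  | idxCopy (a b : ℕ)
  /-- `idx a := idx a + 1` -/
  | idxSucc (a : ℕ)
  /-- `idx a := idx a - 1` (truncated) -/
  | idxPred (a : ℕ)
  /-- `idx a := n` -/
  | readLength (a : ℕ)
  /-- `idx a := size` -/
  | readSize (a : ℕ)
  /-- `idx a := row (idx b)` -/
  | readRow (a b : ℕ)
  /-- `idx a := col (idx b)` -/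
  | readCol (a b : ℕ)
  /-- `real x := weight (idx b)` -/
  | readWeight (x b : ℕ)
  /-- `real x := moment (idx b) d` -/
  | readMoment (x b d : ℕ)
  /-- `real x := 0` -/
  | realZero (x : ℕ)
  /-- `real x := 1` -/
  | realOne (x : ℕ)
  /-- `real x := real y + real z` -/
  | add (x y z : ℕ)
  /-- `real x := real y - real z` -/
  | sub (x y z : ℕ)
  /-- `real x := real y * real z` -/
  | mul (x y z : ℕ)
  /-- `real x := mem r (idx b)` -/
  | load (x r b : ℕ)
  /-- `mem r (idx b) := real x` -/
  | store (r b x : ℕ)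

/-- Programs; the tests compare two index registers. -/
inductive RamProg where
  | instr (c : RamInstr)
  | seq (P Q : RamProg)
  | ifLt (a b : ℕ) (P Q : RamProg)
  | whileLt (a b : ℕ) (P : RamProg)

/-- States of the machine. `used` records the cells of the working memory that have been accessed
so far; its cardinality is the space in use (up to the registers, whose number is determined by
the program). -/
structure RamState where
  idx : ℕ → ℕ
  real : ℕ → ℝ
  mem : ℕ → ℕ → ℝ
  used : Finset (ℕ × ℕ)

namespace RamState

/-- The initial state: nothing has been stored yet. -/
def init : RamState := ⟨fun _ => 0, fun _ => 0, fun _ _ => 0, ∅⟩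

def setIdx (s : RamState) (a v : ℕ) : RamState := { s with idx := Function.update s.idx a v }

def setReal (s : RamState) (x : ℕ) (v : ℝ) : RamState :=
  { s with real := Function.update s.real x v }

def setMem (s : RamState) (r i : ℕ) (v : ℝ) : RamState :=
  { s with mem := Function.update s.mem r (Function.update (s.mem r) i v) }

def touch (s : RamState) (r i : ℕ) : RamState := { s with used := insert (r, i) s.used }

end RamState

/-- The effect of an elementary instruction. Reading outside of the input gives `0`. -/
noncomputable def RamInstr.apply {u : ℕ} (T : ParticleTable u) (s : RamState) :
    RamInstr → RamState
  | idxZero a => s.setIdx a 0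
  | idxCopy a b => s.setIdx a (s.idx b)
  | idxSucc a => s.setIdx a (s.idx a + 1)
  | idxPred a => s.setIdx a (s.idx a - 1)
  | readLength a => s.setIdx a T.n
  | readSize a => s.setIdx a T.size
  | readRow a b => s.setIdx a (if h : s.idx b < T.size then T.row ⟨s.idx b, h⟩ else 0)
  | readCol a b => s.setIdx a (if h : s.idx b < T.size then T.col ⟨s.idx b, h⟩ else 0)
  | readWeight x b => s.setReal x (if h : s.idx b < T.size then T.weight ⟨s.idx b, h⟩ else 0)
  | readMoment x b d => s.setReal x
      (if h : s.idx b < T.size ∧ d < u then T.moment ⟨s.idx b, h.1⟩ ⟨d, h.2⟩ else 0)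
  | realZero x => s.setReal x 0
  | realOne x => s.setReal x 1
  | add x y z => s.setReal x (s.real y + s.real z)
  | sub x y z => s.setReal x (s.real y - s.real z)
  | mul x y z => s.setReal x (s.real y * s.real z)
  | load x r b => (s.setReal x (s.mem r (s.idx b))).touch r (s.idx b)
  | store r b x => (s.setMem r (s.idx b) (s.real x)).touch r (s.idx b)

/-- `RamExec T P s t s'`: started in the state `s` on the input `T`, the program `P` halts after
exactly `t` steps in the state `s'`. Every elementary instruction and every test is one step. -/
inductive RamExec {u : ℕ} (T : ParticleTable u) : RamProg → RamState → ℕ → RamState → Prop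
  | instr (c : RamInstr) (s : RamState) : RamExec T (.instr c) s 1 (c.apply T s)
  | seq {P Q : RamProg} {s s' s'' : RamState} {t t' : ℕ} :
      RamExec T P s t s' → RamExec T Q s' t' s'' → RamExec T (.seq P Q) s (t + t') s''
  | ifTrue {a b : ℕ} {P Q : RamProg} {s s' : RamState} {t : ℕ} :
      s.idx a < s.idx b → RamExec T P s t s' → RamExec T (.ifLt a b P Q) s (t + 1) s'
  | ifFalse {a b : ℕ} {P Q : RamProg} {s s' : RamState} {t : ℕ} :
      ¬ s.idx a < s.idx b → RamExec T Q s t s' → RamExec T (.ifLt a b P Q) s (t + 1) s'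
  | whileFalse {a b : ℕ} {P : RamProg} {s : RamState} :
      ¬ s.idx a < s.idx b → RamExec T (.whileLt a b P) s 1 s
  | whileTrue {a b : ℕ} {P : RamProg} {s s' s'' : RamState} {t t' : ℕ} :
      s.idx a < s.idx b → RamExec T P s t s' → RamExec T (.whileLt a b P) s' t' s'' →
      RamExec T (.whileLt a b P) s (t + t' + 1) s''

/-- The program `P`, run on `T`, halts in a state that satisfies `R`, after at most `K * size`
steps, having accessed at most `K * n` cells of its working memory. -/
def RunsLinearly {u : ℕ} (P : RamProg) (K : ℕ) (T : ParticleTable u) (R : RamState → Prop) :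
    Prop :=
  ∃ t s, RamExec T P RamState.init t s ∧ t ≤ K * T.size ∧ s.used.card ≤ K * T.n ∧ R s

/-! ## The changepoint chain -/

namespace ChangepointModel

open Filtration Preorder

variable {𝕏 𝕐 : Type*} [MeasurableSpace 𝕏] [MeasurableSpace 𝕐] (M : ChangepointModel 𝕏 𝕐)

/-! Everything rests on one linear recursion: `Q (n+1) = 1` and `Q i = ∑ b ∈ Icc i n, w i b * Q
(b+1)`. It expresses that the segment starting at `i` ends at some `b`, and that this end is either
the final time or announces a changepoint at `b + 1`. The right side only uses values at larger
indices, so the recursion has one solution (`IsBackwardSolution.eq`), and it suffices to find three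
solutions.

The posterior is one. A changepoint at `b + 1` regenerates the chain, so the data after `b`
contribute a factor independent of the past (`exists_setLIntegral_jump_likelihood`). Hence, given
all data and that a segment ends at `b`, its start still has the law `backward y n · b`. Given also
the start `j`, the height still has the law `heightLaw y j b`, because the chance of a jump depends
on the start only. Summing over the segments that contain `i` gives the law of the height at `i` as
a mixture (`map_height_posterior`).

The signed law on sets of changepoints is another, for a normalized table. Peeling off the last
segment proves, by induction on the final time, that a segment ending at `b` starts at `j` with
conditional weight `w j b`; normalization makes the part to its left sum to one
(`arrayExpectation_segment`).

The program is the third. It reads the list from its end and, at a particle `(j, b)`, adds `w j b *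
Q (b+1)` to cell `j`. By the order of columns `Q (b+1)` is already final
(`ParticleInvariant.mem_col_succ`). For the vectors, a particle contributes to all times from `j` to
`b`; adding it there directly would not be linear. Instead it is added at `b` and subtracted at `j -
1` in a difference array, and a single pass of suffix sums recovers all averages (`sum_difference`).
-/

theorem measurable_piLE_apply {l m : ℕ} (h : l ≤ m) :
    Measurable[piLE m] fun ω : ℕ → ℕ × 𝕏 => ω l := by
  rw [piLE_eq_comap_frestrictLe]
  exact (measurable_pi_apply (⟨l, Finset.mem_Iic.2 h⟩ : Finset.Iic m)).comp
    (comap_measurable (frestrictLe m))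

instance : IsProbabilityMeasure M.prior := by
  unfold prior; infer_instance

theorem lintegral_stepLaw (i : ℕ) (s : ℕ × 𝕏) {G : ℕ × 𝕏 → ℝ≥0∞} (hG : Measurable G) :
    ∫⁻ s', G s' ∂M.stepLaw i s = ENNReal.ofReal (M.stay s.1 i) * G s
      + ENNReal.ofReal (1 - M.stay s.1 i) * ∫⁻ x, G (i, x) ∂M.J := by
  rw [stepLaw, lintegral_add_measure, lintegral_smul_measure, lintegral_smul_measure,
    lintegral_dirac' _ hG, lintegral_map hG measurable_prodMk_left]
  rfl

/-- The one-step disintegration that characterises `trajMeasure`. The integrand is not a product,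
since the comparison of `ω (m + 1)` with `ω m` needs both arguments jointly. -/
theorem lintegral_prior_frestrictLe (m : ℕ)
    {Φ : (Π _ : Finset.Iic m, ℕ × 𝕏) × (ℕ × 𝕏) → ℝ≥0∞} (hΦ : Measurable Φ) :
    ∫⁻ ω, Φ (frestrictLe m ω, ω (m + 1)) ∂M.prior
      = ∫⁻ ω, ∫⁻ s, Φ (frestrictLe m ω, s) ∂M.stepLaw (m + 1) (ω m) ∂M.prior := by
  have h := Kernel.map_frestrictLe_trajMeasure_compProd_eq_map_trajMeasure
    (X := fun _ => ℕ × 𝕏) (μ₀ := M.initialLaw) (κ := M.historyKernel) (a := m)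
  have h2 := congrArg (fun ν => ∫⁻ z, Φ z ∂ν) h
  beta_reduce at h2
  rw [Measure.lintegral_compProd hΦ, lintegral_map hΦ.lintegral_kernel_prod_right'
    (measurable_frestrictLe m), lintegral_map hΦ (by fun_prop)] at h2
  exact h2.symm

/-- The Markov property of the chain. -/
theorem lintegral_prior_mul_succ {m : ℕ} {F : (ℕ → ℕ × 𝕏) → ℝ≥0∞} (hF : Measurable[piLE m] F)
    {G : ℕ × 𝕏 → ℝ≥0∞} (hG : Measurable G) :
    ∫⁻ ω, F ω * G (ω (m + 1)) ∂M.prior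
      = ∫⁻ ω, F ω * ∫⁻ s, G s ∂M.stepLaw (m + 1) (ω m) ∂M.prior := by
  rw [piLE_eq_comap_frestrictLe] at hF
  obtain ⟨F', hF', rfl⟩ := hF.exists_eq_measurable_comp
  have h := M.lintegral_prior_frestrictLe m (Φ := fun z => F' z.1 * G z.2) (by fun_prop)
  simp only at h
  simp only [Function.comp_apply]
  rw [h]
  exact lintegral_congr fun ω => lintegral_const_mul _ hG

theorem lintegral_prior_zero {G : ℕ × 𝕏 → ℝ≥0∞} (hG : Measurable G) :
    ∫⁻ ω, G (ω 0) ∂M.prior = ∫⁻ x, G (0, x) ∂M.J := by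
  have h : M.prior.map (fun ω => ω 0) = M.initialLaw := by
    have he : Measurable fun z : Π _ : Finset.Iic 0, ℕ × 𝕏 => z ⟨0, by simp⟩ :=
      measurable_pi_apply _
    have h1 : M.prior.map (fun ω => ω 0)
        = (M.prior.map (frestrictLe 0)).map fun z => z ⟨0, by simp⟩ := by
      rw [Measure.map_map he (measurable_frestrictLe 0)]
      rfl
    rw [h1, prior, Kernel.trajMeasure, Measure.map_comp _ _ (measurable_frestrictLe 0),
      Kernel.traj_map_frestrictLe, Kernel.partialTraj_self, Measure.id_comp,
      Measure.map_map he (by fun_prop)]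
    exact Measure.map_id
  rw [← lintegral_map (f := G) hG (measurable_pi_apply 0), h, initialLaw,
    lintegral_map hG measurable_prodMk_left]

theorem ae_fst_zero : ∀ᵐ ω ∂M.prior, (ω 0).1 = 0 := by
  let S : Set (ℕ × 𝕏) := {s | s.1 ≠ 0}
  have hS : MeasurableSet S := measurable_fst (.of_discrete (s := {j : ℕ | j ≠ 0}))
  have hm : Measurable (S.indicator fun _ => (1 : ℝ≥0∞)) := measurable_const.indicator hS
  have h := M.lintegral_prior_zero hm
  have h0 : ∀ x : 𝕏, S.indicator (fun _ => (1 : ℝ≥0∞)) (0, x) = 0 := by simp [S]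
  simp only [h0, lintegral_zero] at h
  replace h := (lintegral_eq_zero_iff (hm.comp (measurable_pi_apply 0))).1 h
  filter_upwards [h] with ω hω
  by_contra hne
  have : ω 0 ∈ S := hne
  simp [this] at hω

/-- At every time either nothing changes or a changepoint occurs. -/
theorem ae_eq_or_fst_eq [StandardBorelSpace 𝕏] :
    ∀ᵐ ω ∂M.prior, ∀ i, ω (i + 1) = ω i ∨ (ω (i + 1)).1 = i + 1 := by
  refine ae_all_iff.2 fun i => ?_
  let S : Set ((Π _ : Finset.Iic i, ℕ × 𝕏) × (ℕ × 𝕏)) :=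
    {z | ¬ (z.2 = z.1 ⟨i, Finset.mem_Iic.2 le_rfl⟩ ∨ z.2.1 = i + 1)}
  have hS : MeasurableSet S := by
    -- A compatible Polish topology makes the diagonal measurable.
    let _ := upgradeStandardBorel 𝕏
    have h1 : MeasurableSet {z : (Π _ : Finset.Iic i, ℕ × 𝕏) × (ℕ × 𝕏) |
        z.2 = z.1 ⟨i, Finset.mem_Iic.2 le_rfl⟩} :=
      measurableSet_eq_fun measurable_snd ((measurable_pi_apply _).comp measurable_fst)
    have h2 : MeasurableSet {z : (Π _ : Finset.Iic i, ℕ × 𝕏) × (ℕ × 𝕏) | z.2.1 = i + 1} :=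
      measurableSet_eq_fun (by fun_prop) measurable_const
    exact (h1.union h2).compl
  have hm : Measurable (S.indicator fun _ => (1 : ℝ≥0∞)) := measurable_const.indicator hS
  have h := M.lintegral_prior_frestrictLe i hm
  have h0 : ∀ ω : ℕ → ℕ × 𝕏,
      ∫⁻ s, S.indicator (fun _ => (1 : ℝ≥0∞)) (frestrictLe i ω, s) ∂M.stepLaw (i + 1) (ω i) = 0 := by
    intro ω
    refine (M.lintegral_stepLaw _ _ (hm.comp measurable_prodMk_left)).trans ?_
    simp [S]
  simp only [h0, lintegral_zero] at h
  replace h := (lintegral_eq_zero_iff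
    (hm.comp ((measurable_frestrictLe i).prodMk (measurable_pi_apply (i + 1))))).1 h
  filter_upwards [h] with ω hω
  by_contra hne
  have : (frestrictLe i ω, ω (i + 1)) ∈ S := hne
  simp [this] at hω

theorem ae_fst_le [StandardBorelSpace 𝕏] : ∀ᵐ ω ∂M.prior, ∀ i, (ω i).1 ≤ i := by
  filter_upwards [M.ae_fst_zero, M.ae_eq_or_fst_eq] with ω h0 h i
  induction i with
  | zero => exact h0.le
  | succ i ih =>
    rcases h i with h | h
    · rw [h]; omega
    · exact h.le

theorem measurable_likelihood (y : ℕ → 𝕐) {i m : ℕ} (h : i ≤ m) :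
    Measurable[piLE m] (M.likelihood (𝕏 := 𝕏) y i) := by
  unfold likelihood
  refine Finset.measurable_fun_prod _ fun l hl => ?_
  have h1 : Measurable fun s : ℕ × 𝕏 => (M.dens l s.2 (y l) : ℝ≥0∞) :=
    ((M.measurable_dens l).comp (measurable_snd.prodMk measurable_const)).coe_nnreal_ennreal
  exact h1.comp (measurable_piLE_apply ((Finset.mem_Icc.1 hl).2.trans h))

end ChangepointModel

/-! ### Regeneration at a changepoint and the likelihood of later data -/

namespace ChangepointModel

open Filtration Preorder

variable {𝕏 𝕐 : Type*} [MeasurableSpace 𝕏] [MeasurableSpace 𝕐] (M : ChangepointModel 𝕏 𝕐)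

theorem measurableSet_piLE_fst_eq {i m : ℕ} (h : i ≤ m) (j : ℕ) :
    MeasurableSet[piLE m] {ω : ℕ → ℕ × 𝕏 | (ω i).1 = j} :=
  (measurable_fst.comp (measurable_piLE_apply h)) (measurableSet_singleton j)

theorem measurableSet_fst_eq (i j : ℕ) : MeasurableSet {ω : ℕ → ℕ × 𝕏 | (ω i).1 = j} :=
  piLE.le i _ (measurableSet_piLE_fst_eq le_rfl j)

theorem measurable_dens_snd (y : ℕ → 𝕐) (l : ℕ) :
    Measurable fun s : ℕ × 𝕏 => (M.dens l s.2 (y l) : ℝ≥0∞) :=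
  ((M.measurable_dens l).comp (measurable_snd.prodMk measurable_const)).coe_nnreal_ennreal

theorem likelihood_zero (y : ℕ → 𝕐) (ω : ℕ → ℕ × 𝕏) : M.likelihood y 0 ω = 1 := by
  simp [likelihood]

theorem likelihood_succ (y : ℕ → 𝕐) (i : ℕ) (ω : ℕ → ℕ × 𝕏) :
    M.likelihood y (i + 1) ω
      = M.likelihood y i ω * (M.dens (i + 1) (ω (i + 1)).2 (y (i + 1)) : ℝ≥0∞) :=
  Finset.prod_Icc_succ_top (by omega) _

theorem sum_restrict_fst_eq {ν : Measure (ℕ → ℕ × 𝕏)} {i : ℕ} (hν : ∀ᵐ ω ∂ν, (ω i).1 ≤ i) :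
    ∑ j ∈ Finset.range (i + 1), ν.restrict {ω | (ω i).1 = j} = ν := by
  ext A hA
  rw [Measure.finsetSum_apply]
  simp only [Measure.restrict_apply hA]
  rw [← measure_biUnion_finset]
  · refine measure_congr (Filter.eventuallyEq_set.2 ?_)
    filter_upwards [hν] with ω hω
    simp only [Finset.mem_range, Set.mem_iUnion, exists_prop]
    exact ⟨fun ⟨j, _, h, _⟩ => h, fun h => ⟨_, by omega, h, rfl⟩⟩
  · intro j _ k _ hjk
    refine Set.disjoint_left.2 fun ω h1 h2 => hjk ?_
    exact h1.2.symm.trans h2.2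
  · exact fun j _ => hA.inter (measurableSet_fst_eq i j)

/-- The chain regenerates at a changepoint. -/
theorem setLIntegral_jump [StandardBorelSpace 𝕏] {m : ℕ} {F : (ℕ → ℕ × 𝕏) → ℝ≥0∞}
    (hF : Measurable[piLE m] F) {G : ℕ × 𝕏 → ℝ≥0∞} (hG : Measurable G) :
    ∫⁻ ω in {ω | (ω (m + 1)).1 = m + 1}, F ω * G (ω (m + 1)) ∂M.prior
      = (∫⁻ ω, F ω * ENNReal.ofReal (1 - M.stay (ω m).1 (m + 1)) ∂M.prior)
        * ∫⁻ x, G (m + 1, x) ∂M.J := by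
  let S : Set (ℕ × 𝕏) := {s | s.1 = m + 1}
  have hS : MeasurableSet S := measurable_fst (measurableSet_singleton (m + 1))
  have hq : Measurable fun ω : ℕ → ℕ × 𝕏 =>
      F ω * ENNReal.ofReal (1 - M.stay (ω m).1 (m + 1)) :=
    (hF.mono (piLE.le m) le_rfl).mul
      ((measurable_of_countable fun j : ℕ => ENNReal.ofReal (1 - M.stay j (m + 1))).comp
        (measurable_fst.comp (measurable_pi_apply m)))
  rw [← lintegral_indicator (measurableSet_fst_eq _ _), ← lintegral_mul_const _ hq]
  calc _ = ∫⁻ ω, F ω * S.indicator G (ω (m + 1)) ∂M.prior := by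
        refine lintegral_congr fun ω => ?_
        by_cases h : (ω (m + 1)).1 = m + 1 <;> simp [S, h]
    _ = _ := by
        rw [M.lintegral_prior_mul_succ hF (hG.indicator hS)]
        refine lintegral_congr_ae ?_
        filter_upwards [M.ae_fst_le] with ω hω
        -- Since `C_m ≤ m` almost surely, staying put cannot produce the value `m + 1`; only the
        -- jump branch of `stepLaw` contributes.
        have h1 : ω m ∉ S := by
          have := hω m
          simp only [S, Set.mem_ofPred_eq]
          omega
        have h2 : ∀ x : 𝕏, S.indicator G (m + 1, x) = G (m + 1, x) := fun x => by simp [S]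
        rw [M.lintegral_stepLaw _ _ (hG.indicator hS)]
        simp only [Set.indicator_of_notMem h1, h2, mul_zero, zero_add, mul_assoc]

/-- The function `β` is the backward message: the expected likelihood of the next `k` observations
given the current state. It is built one step at a time by the Markov property. -/
theorem exists_lintegral_future (y : ℕ → 𝕐) (k : ℕ) : ∀ m : ℕ,
    ∃ β : ℕ × 𝕏 → ℝ≥0∞, Measurable β ∧ ∀ F : (ℕ → ℕ × 𝕏) → ℝ≥0∞, Measurable[piLE m] F →
      ∫⁻ ω, F ω * ∏ l ∈ Finset.Ioc m (m + k), (M.dens l (ω l).2 (y l) : ℝ≥0∞) ∂M.prior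
        = ∫⁻ ω, F ω * β (ω m) ∂M.prior := by
  induction k with
  | zero => exact fun m => ⟨1, measurable_const, fun F _ => by simp⟩
  | succ k ih =>
    intro m
    obtain ⟨β, hβ, h⟩ := ih (m + 1)
    have hG : Measurable fun s : ℕ × 𝕏 => (M.dens (m + 1) s.2 (y (m + 1)) : ℝ≥0∞) * β s :=
      (M.measurable_dens_snd y (m + 1)).mul hβ
    refine ⟨fun s => ∫⁻ s', M.dens (m + 1) s'.2 (y (m + 1)) * β s' ∂M.stepLaw (m + 1) s,
      (Measure.measurable_lintegral hG).comp (M.measurable_stepLaw (m + 1)), fun F hF => ?_⟩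
    rw [← M.lintegral_prior_mul_succ hF hG]
    have h' := h (fun ω => F ω * M.dens (m + 1) (ω (m + 1)).2 (y (m + 1)))
      ((hF.mono (piLE.mono (Nat.le_succ m)) le_rfl).mul
        ((M.measurable_dens_snd y (m + 1)).comp (measurable_piLE_apply le_rfl)))
    simp only [mul_assoc] at h'
    rw [← h']
    refine lintegral_congr fun ω => ?_
    rw [← Finset.prod_Ioc_consecutive _ (Nat.le_succ m) (by omega : m + 1 ≤ m + (k + 1)),
      Nat.Ioc_succ_singleton, Finset.prod_singleton, add_right_comm, add_assoc m k 1]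

/-- After a jump at `i + 1` the height is a fresh draw from `J`, so integrating the backward message
over it gives a constant. That `R` does not depend on `A` is what lets it cancel in conditional
probabilities. -/
theorem exists_setLIntegral_jump_likelihood [StandardBorelSpace 𝕏] (y : ℕ → 𝕐) {i n : ℕ}
    (hin : i < n) :
    ∃ R : ℝ≥0∞, ∀ A : Set (ℕ → ℕ × 𝕏), MeasurableSet[piLE i] A →
      ∫⁻ ω in A ∩ {ω | (ω (i + 1)).1 = i + 1}, M.likelihood y n ω ∂M.prior
        = (∫⁻ ω in A ∩ {ω | (ω (i + 1)).1 = i + 1}, M.likelihood y i ω ∂M.prior) * R := by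
  obtain ⟨k, rfl⟩ := Nat.exists_eq_add_of_lt hin
  obtain ⟨β, hβ, h⟩ := M.exists_lintegral_future y k (i + 1)
  refine ⟨∫⁻ x, M.dens (i + 1) x (y (i + 1)) * β (i + 1, x) ∂M.J, fun A hA => ?_⟩
  set E : Set (ℕ → ℕ × 𝕏) := {ω | (ω (i + 1)).1 = i + 1} with hE
  have hEm : MeasurableSet E := measurableSet_fst_eq _ _
  have hF : Measurable[piLE i] (A.indicator (M.likelihood y i)) :=
    (M.measurable_likelihood y le_rfl).indicator hA
  have hG : Measurable fun s : ℕ × 𝕏 => (M.dens (i + 1) s.2 (y (i + 1)) : ℝ≥0∞) * β s :=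
    (M.measurable_dens_snd y (i + 1)).mul hβ
  have h1 := M.setLIntegral_jump hF hG
  -- The case `G = 1` identifies the prefactor in `h1` as the likelihood up to `i`, integrated over
  -- the jump event.
  have h2 := M.setLIntegral_jump hF (measurable_const (a := (1 : ℝ≥0∞)))
  have : IsProbabilityMeasure M.J := M.isProbabilityMeasure_J
  simp only [mul_one, lintegral_const, measure_univ] at h2
  rw [← h2] at h1
  have h3 := h (E.indicator fun ω => A.indicator (M.likelihood y i) ω
      * M.dens (i + 1) (ω (i + 1)).2 (y (i + 1)))
    (((hF.mono (piLE.mono (Nat.le_succ i)) le_rfl).mul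
      ((M.measurable_dens_snd y (i + 1)).comp (measurable_piLE_apply le_rfl))).indicator
      (measurableSet_piLE_fst_eq le_rfl _))
  have hA' := piLE.le i _ hA
  rw [← setLIntegral_indicator hA', ← setLIntegral_indicator hA']
  refine Eq.trans ?_ h1
  rw [← lintegral_indicator hEm, ← lintegral_indicator hEm]
  refine Eq.trans (lintegral_congr fun ω => ?_) (h3.trans (lintegral_congr fun ω => ?_))
  · by_cases hω : ω ∈ E <;> by_cases hωA : ω ∈ A <;> simp only [hω, hωA, Set.indicator_of_mem,
      Set.indicator_of_notMem, not_false_eq_true, zero_mul]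
    simp only [likelihood]
    rw [show Finset.Icc 1 (i + k + 1) = Finset.Ioc 0 (i + k + 1) from rfl,
      ← Finset.prod_Ioc_consecutive _ (Nat.zero_le i) (by omega : i ≤ i + k + 1),
      ← Finset.prod_Ioc_consecutive _ (Nat.le_succ i) (by omega : i + 1 ≤ i + k + 1),
      Nat.Ioc_succ_singleton, Finset.prod_singleton, add_right_comm, mul_assoc]
    rfl
  · by_cases hω : ω ∈ E <;> simp [hω, mul_assoc]

/-- The chance of a changepoint depends on the start of the current segment only. -/
theorem setLIntegral_jump_of_subset [StandardBorelSpace 𝕏] (y : ℕ → 𝕐) {i j : ℕ}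
    {A : Set (ℕ → ℕ × 𝕏)} (hA : MeasurableSet[piLE i] A) (hAj : A ⊆ {ω | (ω i).1 = j}) :
    ∫⁻ ω in A ∩ {ω | (ω (i + 1)).1 = i + 1}, M.likelihood y i ω ∂M.prior
      = ENNReal.ofReal (1 - M.stay j (i + 1)) * ∫⁻ ω in A, M.likelihood y i ω ∂M.prior := by
  have hA' := piLE.le i _ hA
  have hF : Measurable[piLE i] (A.indicator (M.likelihood y i)) :=
    (M.measurable_likelihood y le_rfl).indicator hA
  have h2 := M.setLIntegral_jump hF (measurable_const (a := (1 : ℝ≥0∞)))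
  have : IsProbabilityMeasure M.J := M.isProbabilityMeasure_J
  simp only [mul_one, lintegral_const, measure_univ] at h2
  rw [← setLIntegral_indicator hA', h2, ← lintegral_indicator hA',
    ← lintegral_const_mul _ (hF.mono (piLE.le i) le_rfl)]
  refine lintegral_congr fun ω => ?_
  by_cases hω : ω ∈ A
  · have : (ω i).1 = j := hAj hω
    rw [this, mul_comm]
  · simp [hω]

end ChangepointModel

/-! ### Bayes formula: the posterior decomposed by segments -/

namespace ChangepointModel

open Filtration Preorder

/-- The event that a segment ends at time `i`, where `n` is the final time. -/
def segmentEnds (𝕏 : Type*) (n i : ℕ) : Set (ℕ → ℕ × 𝕏) :=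
  {ω | i = n ∨ (ω (i + 1)).1 = i + 1}

theorem segmentEnds_self {𝕏 : Type*} (n : ℕ) : segmentEnds 𝕏 n n = Set.univ := by simp [segmentEnds]

theorem segmentEnds_of_lt {𝕏 : Type*} {n i : ℕ} (h : i < n) :
    segmentEnds 𝕏 n i = {ω | (ω (i + 1)).1 = i + 1} := by
  ext ω; simp [segmentEnds, h.ne]

variable {𝕏 𝕐 : Type*} [MeasurableSpace 𝕏] [MeasurableSpace 𝕐] (M : ChangepointModel 𝕏 𝕐)

/-- The marginal likelihoods of all segments up to time `n` are positive and finite. -/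
def RegularData (y : ℕ → 𝕐) (n : ℕ) : Prop :=
  ∀ j i, 0 < j → j ≤ i → i ≤ n → 0 < M.segmentIntegral y j i ∧ M.segmentIntegral y j i < ⊤

/-- On `C_i = j`, the unnormalised law of `X_i` given the data has, up to a constant, the density
of the observations in the segment `{j, ..., i}`. -/
theorem exists_setLIntegral_segment [StandardBorelSpace 𝕏] {y : ℕ → 𝕐} {n : ℕ}
    (hy : M.RegularData y n) {i : ℕ} (hi : i ≤ n) :
    ∃ κ : ℕ → ℝ≥0∞, (∀ j, κ j ≠ ⊤) ∧ (∃ j ≤ i, κ j ≠ 0) ∧ ∀ j ≤ i, ∀ g : 𝕏 → ℝ≥0∞, Measurable g →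
      ∫⁻ ω in {ω | (ω i).1 = j}, M.likelihood y i ω * g (ω i).2 ∂M.prior
        = κ j * ∫⁻ x, (∏ l ∈ Finset.Icc (max j 1) i, (M.dens l x (y l) : ℝ≥0∞)) * g x ∂M.J := by
  have : IsProbabilityMeasure M.J := M.isProbabilityMeasure_J
  induction i with
  | zero =>
    -- There is no observation at time 0; this is also why the initial segment enters through `max j
    -- 1`.
    refine ⟨fun _ => 1, by simp, ⟨0, by simp⟩, fun j hj g hg => ?_⟩
    obtain rfl : j = 0 := by omega
    have h := M.lintegral_prior_zero (hg.comp measurable_snd)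
    have h0 : ∀ᵐ ω ∂M.prior, ω ∈ {ω : ℕ → ℕ × 𝕏 | (ω 0).1 = 0} := M.ae_fst_zero
    rw [Measure.restrict_eq_self_of_ae_mem h0]
    simpa [likelihood_zero] using h
  | succ i ih =>
    obtain ⟨κ, hκ, ⟨j₀, hj₀, hκ₀⟩, h⟩ := ih (by omega)
    have hseg : ∀ j ≤ i, ∫⁻ ω in {ω | (ω i).1 = j}, M.likelihood y i ω ∂M.prior ≠ ⊤ ∧
        (κ j ≠ 0 → ∫⁻ ω in {ω | (ω i).1 = j}, M.likelihood y i ω ∂M.prior ≠ 0) := by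
      intro j hj
      have h1 := h j hj (fun _ => 1) measurable_const
      simp only [mul_one] at h1
      have h2 : 0 < M.segmentIntegral y (max j 1) i ∧ M.segmentIntegral y (max j 1) i < ⊤ := by
        rcases Nat.eq_zero_or_pos i with rfl | hi0
        · simp [segmentIntegral, show max j 1 = 1 by omega]
        · exact hy _ _ (by omega) (by omega) (by omega)
      rw [h1]
      exact ⟨ENNReal.mul_ne_top (hκ j) h2.2.ne, fun hk => mul_ne_zero hk h2.1.ne'⟩
    have hsum := fun F : (ℕ → ℕ × 𝕏) → ℝ≥0∞ => congrArg (fun ν => ∫⁻ ω, F ω ∂ν)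
      (sum_restrict_fst_eq (M.ae_fst_le.mono fun ω h => h i))
    simp only [lintegral_finsetSum_measure] at hsum
    set c := ∫⁻ ω, M.likelihood y i ω * ENNReal.ofReal (1 - M.stay (ω i).1 (i + 1)) ∂M.prior
      with hc
    have hctop : c ≠ ⊤ := by
      refine ne_top_of_le_ne_top (b := ∫⁻ ω, M.likelihood y i ω ∂M.prior) ?_ ?_
      · rw [← hsum]
        exact ENNReal.sum_ne_top.2 fun j hj =>
          (hseg j (Nat.lt_succ_iff.1 (Finset.mem_range.1 hj))).1
      · refine lintegral_mono fun ω => mul_le_of_le_one_right' ?_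
        exact ENNReal.ofReal_le_one.2 (by linarith [(M.stay (ω i).1 (i + 1)).2.1])
    -- A new segment receives the total jump mass `c`; an old one keeps its constant times the
    -- probability of staying.
    refine ⟨fun j => if j = i + 1 then c else ENNReal.ofReal (M.stay j (i + 1)) * κ j,
      fun j => ?_, ?_, fun j hj g hg => ?_⟩
    · dsimp only
      split_ifs
      exacts [hctop, ENNReal.mul_ne_top ENNReal.ofReal_ne_top (hκ j)]
    -- If staying at `j₀` is impossible, all its positive mass jumps and `c` is nonzero; otherwise
    -- `j₀` keeps a nonzero constant.
    · by_cases hq : (M.stay j₀ (i + 1) : ℝ) = 0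
      · refine ⟨i + 1, le_rfl, ?_⟩
        dsimp only
        rw [if_pos rfl]
        refine ne_of_gt (lt_of_lt_of_le (pos_iff_ne_zero.2 ((hseg j₀ hj₀).2 hκ₀)) ?_)
        rw [hc, ← lintegral_indicator (measurableSet_fst_eq _ _)]
        refine lintegral_mono fun ω => ?_
        by_cases hω : (ω i).1 = j₀ <;> simp [hω, hq]
      · refine ⟨j₀, by omega, ?_⟩
        dsimp only
        rw [if_neg (by omega)]
        refine mul_ne_zero (ENNReal.ofReal_pos.2 ?_).ne' hκ₀
        exact lt_of_le_of_ne (M.stay j₀ (i + 1)).2.1 (Ne.symm hq)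
    · have hG : Measurable fun s : ℕ × 𝕏 => (M.dens (i + 1) s.2 (y (i + 1)) : ℝ≥0∞) * g s.2 :=
        (M.measurable_dens_snd y (i + 1)).mul (hg.comp measurable_snd)
      have hL := M.measurable_likelihood y (le_refl i)
      simp only [likelihood_succ, mul_assoc]
      rcases hj.eq_or_lt with rfl | hj
      · rw [if_pos rfl, M.setLIntegral_jump hL hG, max_eq_left (by omega), hc]
        simp
      · have hji : j ≤ i := by omega
        let S : Set (ℕ × 𝕏) := {s | s.1 = j}
        have hS : MeasurableSet S := measurable_fst (measurableSet_singleton j)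
        have hgp : Measurable fun x => (M.dens (i + 1) x (y (i + 1)) : ℝ≥0∞) * g x :=
          hG.comp (measurable_prodMk_left (x := 0))
        have h1 := h j hji _ hgp
        have h2 := M.lintegral_prior_mul_succ hL (hG.indicator hS)
        -- For an old start `j < i + 1` only the branch without a jump contributes.
        have hSj : ∀ x : 𝕏, (i + 1, x) ∉ S := fun x => by simp [S]; omega
        simp only [M.lintegral_stepLaw _ _ (hG.indicator hS), Set.indicator_of_notMem (hSj _),
          lintegral_zero, mul_zero, add_zero] at h2
        rw [if_neg (by omega), mul_assoc]
        simp only [Finset.prod_Icc_succ_top (by omega : max j 1 ≤ i + 1), mul_assoc]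
        rw [← h1, ← lintegral_const_mul', ← lintegral_indicator (measurableSet_fst_eq _ _)]
        · rw [← lintegral_indicator (measurableSet_fst_eq _ _)]
          refine Eq.trans (lintegral_congr fun ω => ?_) (h2.trans (lintegral_congr fun ω => ?_))
          · by_cases hω : (ω (i + 1)).1 = j <;> simp [hω, S]
          · by_cases hω : (ω i).1 = j <;> simp [hω, S]; ring
        · exact ENNReal.ofReal_ne_top

theorem evidence_ne_zero_and_ne_top [StandardBorelSpace 𝕏] {y : ℕ → 𝕐} {n : ℕ}
    (hy : M.RegularData y n) {i : ℕ} (hi0 : 1 ≤ i) (hi : i ≤ n) :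
    M.evidence y i ≠ 0 ∧ M.evidence y i ≠ ⊤ := by
  obtain ⟨κ, hκ, ⟨j₀, hj₀, hκ₀⟩, h⟩ := M.exists_setLIntegral_segment hy hi
  have h1 : ∀ j ≤ i, ∫⁻ ω in {ω | (ω i).1 = j}, M.likelihood y i ω ∂M.prior
      = κ j * M.segmentIntegral y (max j 1) i := fun j hj => by
    simpa [segmentIntegral] using h j hj (fun _ => 1) measurable_const
  have hseg : ∀ j ≤ i, 0 < M.segmentIntegral y (max j 1) i ∧
    M.segmentIntegral y (max j 1) i < ⊤ := fun j hj => hy _ _ (by omega) (by omega) hi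
  constructor
  · refine ne_of_gt (lt_of_lt_of_le ?_ (setLIntegral_le_lintegral {ω | (ω i).1 = j₀} _))
    rw [h1 j₀ hj₀]
    exact pos_iff_ne_zero.2 (mul_ne_zero hκ₀ (hseg j₀ hj₀).1.ne')
  · rw [evidence, ← sum_restrict_fst_eq (M.ae_fst_le.mono fun ω h => h i),
      lintegral_finsetSum_measure]
    refine ENNReal.sum_ne_top.2 fun j hj => ?_
    have hj := Nat.lt_succ_iff.1 (Finset.mem_range.1 hj)
    rw [h1 j hj]
    exact ENNReal.mul_ne_top (hκ j) (hseg j hj).2.ne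

theorem posterior_apply (y : ℕ → 𝕐) (m : ℕ) {A : Set (ℕ → ℕ × 𝕏)} (hA : MeasurableSet A) :
    M.posterior y m A = (M.evidence y m)⁻¹ * ∫⁻ ω in A, M.likelihood y m ω ∂M.prior := by
  rw [posterior, Measure.smul_apply, withDensity_apply _ hA, smul_eq_mul]

theorem isProbabilityMeasure_posterior [StandardBorelSpace 𝕏] {y : ℕ → 𝕐} {n : ℕ}
    (hy : M.RegularData y n) {i : ℕ} (hi0 : 1 ≤ i) (hi : i ≤ n) :
    IsProbabilityMeasure (M.posterior y i) := by
  obtain ⟨h0, htop⟩ := M.evidence_ne_zero_and_ne_top hy hi0 hi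
  refine ⟨?_⟩
  rw [M.posterior_apply y i .univ, setLIntegral_univ]
  exact ENNReal.inv_mul_cancel h0 htop

theorem posterior_absolutelyContinuous (y : ℕ → 𝕐) (m : ℕ) : M.posterior y m ≪ M.prior :=
  (withDensity_absolutelyContinuous _ _).smul_left _

theorem measurableSet_segmentEnds (n i : ℕ) : MeasurableSet (segmentEnds 𝕏 n i) := by
  rcases eq_or_ne i n with rfl | h
  · rw [segmentEnds_self]; exact .univ
  · have : segmentEnds 𝕏 n i = {ω | (ω (i + 1)).1 = i + 1} := by ext ω; simp [segmentEnds, h]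
    rw [this]
    exact measurableSet_fst_eq _ _

/-- For `i < n`, the data after `i` multiply both events by the same factor `R`, so the conditional
law of the start given `y_{1:i}` survives conditioning on all data. -/
theorem posterior_fst_eq_inter_segmentEnds [StandardBorelSpace 𝕏] {y : ℕ → 𝕐} {n : ℕ}
    (hy : M.RegularData y n) {i : ℕ} (hi0 : 1 ≤ i) (hi : i ≤ n) (j : ℕ) :
    M.posterior y n ({ω | (ω i).1 = j} ∩ segmentEnds 𝕏 n i)
      = ENNReal.ofReal (M.backward y n j i) * M.posterior y n (segmentEnds 𝕏 n i) := by
  have hn := M.isProbabilityMeasure_posterior hy (hi0.trans hi) le_rfl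
  rcases hi.eq_or_lt with rfl | hin
  · rw [segmentEnds_self, Set.inter_univ, measure_univ, mul_one, backward, if_pos rfl,
      ofReal_measureReal]
  · have hpi := M.isProbabilityMeasure_posterior hy hi0 hi
    obtain ⟨h0, htop⟩ := M.evidence_ne_zero_and_ne_top hy hi0 hi
    rw [segmentEnds_of_lt hin, backward, if_neg hin.ne, ofReal_measureReal]
    obtain ⟨R, hR⟩ := M.exists_setLIntegral_jump_likelihood y hin
    have hA := hR _ (measurableSet_piLE_fst_eq le_rfl j)
    have hU := hR Set.univ .univ
    rw [Set.univ_inter] at hU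
    set E : Set (ℕ → ℕ × 𝕏) := {ω | (ω (i + 1)).1 = i + 1}
    have hE : MeasurableSet E := measurableSet_fst_eq _ _
    have hAm : MeasurableSet {ω : ℕ → ℕ × 𝕏 | (ω i).1 = j} := measurableSet_fst_eq _ _
    -- This form needs no case distinction: if `E` is null, both sides vanish.
    have key : M.posterior y i ({ω | (ω i).1 = j} ∩ E)
        = (M.posterior y i)[|E] {ω | (ω i).1 = j} * M.posterior y i E := by
      rw [cond_mul_eq_inter hE, Set.inter_comm]
    rw [M.posterior_apply y i (hAm.inter hE), M.posterior_apply y i hE, mul_left_comm] at key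
    have key2 := (ENNReal.mul_right_inj (ENNReal.inv_ne_zero.2 htop)
      (ENNReal.inv_ne_top.2 h0)).1 key
    rw [M.posterior_apply y n (hAm.inter hE), M.posterior_apply y n hE, hA, hU, key2]
    ring

/-- For `i < n`, once the start `j` is fixed, the jump probability is a constant and so is the
factor `R` of the later data. Neither reweights the height. -/
theorem posterior_height_inter_segmentEnds [StandardBorelSpace 𝕏] {y : ℕ → 𝕐} {n : ℕ}
    (hy : M.RegularData y n) {i : ℕ} (hi0 : 1 ≤ i) (hi : i ≤ n) (j : ℕ) {B : Set 𝕏}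
    (hB : MeasurableSet B) :
    M.posterior y n ({ω | (ω i).1 = j ∧ (ω i).2 ∈ B} ∩ segmentEnds 𝕏 n i)
      = M.posterior y n ({ω | (ω i).1 = j} ∩ segmentEnds 𝕏 n i) * M.heightLaw y j i B := by
  have hpi := M.isProbabilityMeasure_posterior hy hi0 hi
  have hAm : MeasurableSet {ω : ℕ → ℕ × 𝕏 | (ω i).1 = j} := measurableSet_fst_eq _ _
  have hBm' : MeasurableSet[piLE i] {ω : ℕ → ℕ × 𝕏 | (ω i).2 ∈ B} :=
    (measurable_snd.comp (measurable_piLE_apply le_rfl)) hB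
  have hBm := piLE.le i _ hBm'
  have key : M.posterior y i {ω | (ω i).1 = j ∧ (ω i).2 ∈ B}
      = M.posterior y i {ω | (ω i).1 = j} * M.heightLaw y j i B := by
    rw [heightLaw, Measure.map_apply (by fun_prop) hB, mul_comm,
      show (fun ω : ℕ → ℕ × 𝕏 => (ω i).2) ⁻¹' B = {ω | (ω i).2 ∈ B} from rfl,
      cond_mul_eq_inter hAm]
    rfl
  rcases hi.eq_or_lt with rfl | hin
  · rw [segmentEnds_self, Set.inter_univ, Set.inter_univ, key]
  · obtain ⟨h0, htop⟩ := M.evidence_ne_zero_and_ne_top hy hi0 hi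
    rw [segmentEnds_of_lt hin]
    obtain ⟨R, hR⟩ := M.exists_setLIntegral_jump_likelihood y hin
    have hAB' : MeasurableSet[piLE i] {ω : ℕ → ℕ × 𝕏 | (ω i).1 = j ∧ (ω i).2 ∈ B} :=
      (measurableSet_piLE_fst_eq le_rfl j).inter hBm'
    have hAB := piLE.le i _ hAB'
    have hE : MeasurableSet {ω : ℕ → ℕ × 𝕏 | (ω (i + 1)).1 = i + 1} := measurableSet_fst_eq _ _
    rw [M.posterior_apply y i hAB, M.posterior_apply y i hAm, mul_assoc] at key
    have key2 := (ENNReal.mul_right_inj (ENNReal.inv_ne_zero.2 htop)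
      (ENNReal.inv_ne_top.2 h0)).1 key
    rw [M.posterior_apply y n (hAB.inter hE), M.posterior_apply y n (hAm.inter hE), hR _ hAB',
      hR _ (measurableSet_piLE_fst_eq le_rfl j), M.setLIntegral_jump_of_subset y hAB' fun ω h => h.1,
      M.setLIntegral_jump_of_subset y (measurableSet_piLE_fst_eq le_rfl j) subset_rfl, key2]
    ring

/-- A segment that is running at time `i` ends at some time `b`. -/
theorem posterior_height_eq_sum [StandardBorelSpace 𝕏] (y : ℕ → 𝕐) {n i j : ℕ}
    (hi : i ≤ n) (hj : j ≤ i) (B : Set 𝕏) :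
    M.posterior y n {ω | (ω i).1 = j ∧ (ω i).2 ∈ B}
      = ∑ b ∈ Finset.Icc i n,
        M.posterior y n ({ω | (ω b).1 = j ∧ (ω b).2 ∈ B} ∩ segmentEnds 𝕏 n b) := by
  induction hi using Nat.decreasingInduction with
  | self => simp [segmentEnds_self]
  | of_succ i hin ih =>
    rw [← Finset.insert_Icc_succ_left_eq_Icc (by omega : i ≤ n), Finset.sum_insert (by simp),
      Order.succ_eq_add_one, ← ih (by omega), ← measure_inter_add_sdiff _
      (measurableSet_segmentEnds n i)]
    congr 1
    refine measure_congr (Filter.eventuallyEq_set.2 ?_)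
    filter_upwards [(M.posterior_absolutelyContinuous y n).ae_le M.ae_eq_or_fst_eq] with ω hω
    rw [segmentEnds_of_lt hin]
    simp only [Set.mem_sdiff, Set.mem_ofPred_eq]
    constructor
    · rintro ⟨h1, h2⟩
      rwa [(hω i).resolve_right h2]
    · intro h
      -- The start `j ≤ i` at time `i + 1` excludes a jump, so the state is that of time `i`.
      have h2 : ¬ (ω (i + 1)).1 = i + 1 := by omega
      rw [(hω i).resolve_right h2] at h
      exact ⟨h, h2⟩

end ChangepointModel

/-! ### Recursion and mixture formula under the posterior -/

namespace ChangepointModel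

variable {𝕏 𝕐 : Type*} [MeasurableSpace 𝕏] [MeasurableSpace 𝕐] (M : ChangepointModel 𝕏 𝕐)

theorem backward_nonneg (y : ℕ → 𝕐) (n j i : ℕ) : 0 ≤ M.backward y n j i := by
  unfold backward
  split_ifs <;> exact measureReal_nonneg

/-- The backward recursion for the changepoint probabilities. -/
theorem posterior_real_changepoint [StandardBorelSpace 𝕏] {y : ℕ → 𝕐} {n : ℕ}
    (hy : M.RegularData y n) {i : ℕ} (hi0 : 1 ≤ i) (hi : i ≤ n) :
    (M.posterior y n).real {ω | (ω i).1 = i}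
      = ∑ b ∈ Finset.Icc i n,
        M.backward y n i b * (M.posterior y n).real (segmentEnds 𝕏 n b) := by
  have hn := M.isProbabilityMeasure_posterior hy (hi0.trans hi) le_rfl
  have h := M.posterior_height_eq_sum y hi (le_refl i) Set.univ
  simp only [Set.mem_univ, and_true] at h
  rw [measureReal_def, h, ENNReal.toReal_sum fun b _ => measure_ne_top _ _]
  refine Finset.sum_congr rfl fun b hb => ?_
  obtain ⟨h1, h2⟩ := Finset.mem_Icc.1 hb
  rw [M.posterior_fst_eq_inter_segmentEnds hy (hi0.trans h1) h2, ENNReal.toReal_mul,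
    ENNReal.toReal_ofReal (M.backward_nonneg y n i b), measureReal_def]

/-- The posterior law of the height at time `i` is a mixture of the laws of the heights of the
segments that contain `i`. -/
theorem map_height_posterior [StandardBorelSpace 𝕏] {y : ℕ → 𝕐} {n : ℕ}
    (hy : M.RegularData y n) {i : ℕ} (hi0 : 1 ≤ i) (hi : i ≤ n) :
    (M.posterior y n).map (fun ω => (ω i).2)
      = ∑ b ∈ Finset.Icc i n, ∑ j ∈ Finset.range (i + 1),
        (ENNReal.ofReal (M.backward y n j b) * M.posterior y n (segmentEnds 𝕏 n b))
          • M.heightLaw y j b := by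
  ext B hB
  rw [Finset.sum_comm, Measure.map_apply (by fun_prop) hB]
  have hB' : MeasurableSet ((fun ω : ℕ → ℕ × 𝕏 => (ω i).2) ⁻¹' B) :=
    (show Measurable fun ω : ℕ → ℕ × 𝕏 => (ω i).2 by fun_prop) hB
  have hle : ∀ᵐ ω ∂M.posterior y n, (ω i).1 ≤ i := by
    filter_upwards [(M.posterior_absolutelyContinuous y n).ae_le M.ae_fst_le] with ω h using h i
  have hsum := congrArg (fun ν => ν ((fun ω : ℕ → ℕ × 𝕏 => (ω i).2) ⁻¹' B))
    (sum_restrict_fst_eq hle)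
  simp only [Measure.finsetSum_apply, Measure.restrict_apply hB'] at hsum
  rw [← hsum, Measure.finsetSum_apply]
  refine Finset.sum_congr rfl fun j hj => ?_
  have hj := Nat.lt_succ_iff.1 (Finset.mem_range.1 hj)
  rw [Measure.finsetSum_apply, Set.inter_comm]
  refine (M.posterior_height_eq_sum y hi hj B).trans (Finset.sum_congr rfl fun b hb => ?_)
  obtain ⟨h1, h2⟩ := Finset.mem_Icc.1 hb
  rw [M.posterior_height_inter_segmentEnds hy (hi0.trans h1) h2 j hB,
    M.posterior_fst_eq_inter_segmentEnds hy (hi0.trans h1) h2, Measure.smul_apply, smul_eq_mul]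

theorem integrable_and_integral_height [StandardBorelSpace 𝕏] {y : ℕ → 𝕐} {n : ℕ}
    (hy : M.RegularData y n) {u : ℕ} {f : 𝕏 → Fin u → ℝ} (hf : Measurable f)
    (hint : ∀ j b, j ≤ b → 1 ≤ b → b ≤ n → M.backward y n j b ≠ 0 →
      Integrable f (M.heightLaw y j b)) {i : ℕ} (hi0 : 1 ≤ i) (hi : i ≤ n) :
    Integrable (fun ω => f (ω i).2) (M.posterior y n) ∧
      ∫ ω, f (ω i).2 ∂M.posterior y n
        = ∑ b ∈ Finset.Icc i n, ∑ j ∈ Finset.range (i + 1),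
          (M.backward y n j b * (M.posterior y n).real (segmentEnds 𝕏 n b))
            • ∫ x, f x ∂M.heightLaw y j b := by
  have hn := M.isProbabilityMeasure_posterior hy (hi0.trans hi) le_rfl
  have hX : AEMeasurable (fun ω : ℕ → ℕ × 𝕏 => (ω i).2) (M.posterior y n) :=
    (show Measurable fun ω : ℕ → ℕ × 𝕏 => (ω i).2 by fun_prop).aemeasurable
  have hI : ∀ b ∈ Finset.Icc i n, ∀ j ∈ Finset.range (i + 1), Integrable f
      ((ENNReal.ofReal (M.backward y n j b) * M.posterior y n (segmentEnds 𝕏 n b))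
          • M.heightLaw y j b) := by
    intro b hb j hj
    rw [Finset.mem_Icc] at hb
    rw [Finset.mem_range] at hj
    by_cases h0 : M.backward y n j b = 0
    · simp [h0]
    · exact (hint j b (by omega) (by omega) hb.2 h0).smul_measure
        (ENNReal.mul_ne_top ENNReal.ofReal_ne_top (measure_ne_top _ _))
  constructor
  · rw [← Function.comp_def f,
      ← integrable_map_measure hf.aestronglyMeasurable hX, M.map_height_posterior hy hi0 hi]
    exact integrable_finsetSum_measure.2 fun b hb => integrable_finsetSum_measure.2 (hI b hb)
  · rw [← integral_map hX hf.aestronglyMeasurable, M.map_height_posterior hy hi0 hi,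
      integral_finsetSum_measure fun b hb => integrable_finsetSum_measure.2 (hI b hb)]
    refine Finset.sum_congr rfl fun b hb => ?_
    rw [integral_finsetSum_measure (hI b hb)]
    refine Finset.sum_congr rfl fun j hj => ?_
    rw [integral_smul_measure, ENNReal.toReal_mul,
      ENNReal.toReal_ofReal (M.backward_nonneg y n j b), measureReal_def]

end ChangepointModel

/-! ## Sums over sets of changepoints -/

/-- Nonempty sets are sorted by their largest element `t`. -/
theorem Finset.sum_powerset_Icc_eq_sum_max {β : Type*} [AddCommMonoid β] (F : Finset ℕ → β)
    (n : ℕ) :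
    ∑ τ ∈ (Finset.Icc 1 n).powerset, F τ
      = F ∅ + ∑ t ∈ Finset.Icc 1 n, ∑ τ ∈ (Finset.Icc 1 (t - 1)).powerset, F (insert t τ) := by
  induction n with
  | zero => simp
  | succ n ih =>
    rw [← Finset.insert_Icc_right_eq_Icc_add_one (by omega : 1 ≤ n + 1),
      Finset.sum_powerset_insert (by simp), Finset.sum_insert (by simp), ih, Nat.add_sub_cancel,
      add_assoc, add_comm (∑ t ∈ Finset.Icc 1 n, _)]

namespace ParticleTable

section Array

variable (w : ℕ → ℕ → ℝ)

theorem mem_of_lastChangepoint_pos {τ : Finset ℕ} {i : ℕ} (h : lastChangepoint τ i ≠ 0) :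
    lastChangepoint τ i ∈ τ := by
  have hne : (τ.filter (· ≤ i)).Nonempty := by
    by_contra hne
    rw [Finset.not_nonempty_iff_eq_empty] at hne
    simp [lastChangepoint, hne] at h
  obtain ⟨t, ht, h⟩ := Finset.exists_mem_eq_sup _ hne id
  rw [lastChangepoint, h]
  exact (Finset.mem_filter.1 ht).1

theorem lastChangepoint_le (τ : Finset ℕ) (i : ℕ) : lastChangepoint τ i ≤ i :=
  Finset.sup_le fun _ hj => (Finset.mem_filter.1 hj).2

theorem le_lastChangepoint {τ : Finset ℕ} {t i : ℕ} (ht : t ∈ τ) (h : t ≤ i) :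
    t ≤ lastChangepoint τ i :=
  Finset.le_sup (f := id) (Finset.mem_filter.2 ⟨ht, h⟩)

theorem lastChangepoint_eq_self_iff {τ : Finset ℕ} {i : ℕ} (hi : 1 ≤ i) :
    lastChangepoint τ i = i ↔ i ∈ τ := by
  constructor
  · intro h
    have := mem_of_lastChangepoint_pos (τ := τ) (i := i) (by omega)
    rwa [h] at this
  · exact fun h => le_antisymm (lastChangepoint_le _ _) (le_lastChangepoint h le_rfl)

theorem lastChangepoint_congr {τ σ : Finset ℕ} {i k : ℕ}
    (h : ∀ t, (t ∈ τ ∧ t ≤ i) ↔ (t ∈ σ ∧ t ≤ k)) :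
    lastChangepoint τ i = lastChangepoint σ k := by
  unfold lastChangepoint
  congr 1
  ext t
  simpa using h t

theorem lastChangepoint_insert_of_lt {τ : Finset ℕ} {t i : ℕ} (h : i < t) :
    lastChangepoint (insert t τ) i = lastChangepoint τ i := by
  refine lastChangepoint_congr fun s => ?_
  simp only [Finset.mem_insert]
  constructor
  · rintro ⟨rfl | h1, h2⟩
    · omega
    · exact ⟨h1, h2⟩
  · exact fun ⟨h1, h2⟩ => ⟨.inr h1, h2⟩

theorem lastChangepoint_insert_of_le {τ : Finset ℕ} {t i : ℕ} (h : t ≤ i)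
    (hτ : τ ⊆ Finset.Icc 1 (t - 1)) : lastChangepoint (insert t τ) i = t := by
  refine le_antisymm (Finset.sup_le fun s hs => ?_) (le_lastChangepoint (by simp) h)
  obtain ⟨hs, -⟩ := Finset.mem_filter.1 hs
  rcases Finset.mem_insert.1 hs with rfl | hs
  · exact le_rfl
  · have := Finset.mem_Icc.1 (hτ hs)
    simp only [id]
    omega

/-- The weight of the set `τ` of changepoints in `{1, ..., n}`, for the array `w`. -/
def arrayWeight (n : ℕ) (τ : Finset ℕ) : ℝ :=
  ∏ i ∈ (Finset.Icc 1 n).filter (fun i => i = n ∨ i + 1 ∈ τ), w (lastChangepoint τ i) i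

/-- The expectation of `F` for the signed law on sets of changepoints given by the array `w`. -/
def arrayExpectation (n : ℕ) (F : Finset ℕ → ℝ) : ℝ :=
  ∑ τ ∈ (Finset.Icc 1 n).powerset, arrayWeight w n τ * F τ

theorem arrayWeight_empty {n : ℕ} (hn : 1 ≤ n) : arrayWeight w n ∅ = w 0 n := by
  have : (Finset.Icc 1 n).filter (fun i => i = n ∨ i + 1 ∈ (∅ : Finset ℕ)) = {n} := by
    ext i; simp; omega
  rw [arrayWeight, this, Finset.prod_singleton]
  rfl

/-- Removing the last segment `{t, ..., n}` leaves a segmentation with final time `t - 1`. For `t =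
1` this is the empty product, in agreement with `w 0 0` counting as one. -/
theorem arrayWeight_insert {n t : ℕ} (ht : t ∈ Finset.Icc 1 n) {τ : Finset ℕ}
    (hτ : τ ⊆ Finset.Icc 1 (t - 1)) :
    arrayWeight w n (insert t τ) = w t n * arrayWeight w (t - 1) τ := by
  rw [Finset.mem_Icc] at ht
  have : (Finset.Icc 1 n).filter (fun i => i = n ∨ i + 1 ∈ insert t τ)
      = insert n ((Finset.Icc 1 (t - 1)).filter fun i => i = t - 1 ∨ i + 1 ∈ τ) := by
    ext i
    have hi : i + 1 ∈ τ → i + 1 ≤ t - 1 := fun h => (Finset.mem_Icc.1 (hτ h)).2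
    simp only [Finset.mem_filter, Finset.mem_Icc, Finset.mem_insert]
    constructor
    · rintro ⟨h1, h | h | h⟩
      · exact .inl h
      · right; omega
      · have := hi h
        exact .inr ⟨by omega, .inr h⟩
    · rintro (h | ⟨h1, h | h⟩)
      · omega
      · omega
      · exact ⟨by omega, .inr (.inr h)⟩
  rw [arrayWeight, this, Finset.prod_insert (by simp; omega),
    lastChangepoint_insert_of_le ht.2 hτ, arrayWeight]
  congr 1
  refine Finset.prod_congr rfl fun i hi => ?_
  have := Finset.mem_Icc.1 (Finset.mem_filter.1 hi).1
  rw [lastChangepoint_insert_of_lt (by omega)]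

theorem arrayExpectation_eq {n : ℕ} (hn : 1 ≤ n) (F : Finset ℕ → ℝ) :
    arrayExpectation w n F = w 0 n * F ∅
      + ∑ t ∈ Finset.Icc 1 n, w t n * arrayExpectation w (t - 1) fun τ => F (insert t τ) := by
  rw [arrayExpectation, Finset.sum_powerset_Icc_eq_sum_max, arrayWeight_empty w hn]
  congr 1
  refine Finset.sum_congr rfl fun t ht => ?_
  rw [arrayExpectation, Finset.mul_sum]
  refine Finset.sum_congr rfl fun τ hτ => ?_
  rw [arrayWeight_insert w ht (Finset.mem_powerset.1 hτ), mul_assoc]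

theorem arrayExpectation_congr {n : ℕ} {F G : Finset ℕ → ℝ}
    (h : ∀ τ ⊆ Finset.Icc 1 n, F τ = G τ) : arrayExpectation w n F = arrayExpectation w n G :=
  Finset.sum_congr rfl fun τ hτ => by rw [h τ (Finset.mem_powerset.1 hτ)]

theorem arrayExpectation_zero (n : ℕ) : arrayExpectation w n (fun _ => 0) = 0 := by
  simp [arrayExpectation]

variable {w}

theorem arrayExpectation_one {n : ℕ}
    (hw : ∀ i ∈ Finset.Icc 1 n, ∑ j ∈ Finset.range (i + 1), w j i = 1) :
    arrayExpectation w n (fun _ => 1) = 1 := by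
  induction n using Nat.strong_induction_on with
  | _ n ih =>
    rcases Nat.eq_zero_or_pos n with rfl | hn
    · simp [arrayExpectation, arrayWeight]
    · have h := hw n (Finset.mem_Icc.2 ⟨hn, le_rfl⟩)
      rw [show Finset.range (n + 1) = insert 0 (Finset.Icc 1 n) by ext; simp; omega,
        Finset.sum_insert (by simp)] at h
      rw [arrayExpectation_eq w hn, mul_one]
      refine Eq.trans ?_ h
      congr 1
      refine Finset.sum_congr rfl fun t ht => ?_
      rw [Finset.mem_Icc] at ht
      rw [ih (t - 1) (by omega) fun i hi => hw i (by simp at hi ⊢; omega), mul_one]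

theorem arrayExpectation_lastChangepoint {n : ℕ}
    (hw : ∀ i ∈ Finset.Icc 1 n, ∑ j ∈ Finset.range (i + 1), w j i = 1) (hn : 1 ≤ n) {j : ℕ}
    (hj : j ≤ n) :
    arrayExpectation w n (fun τ => if lastChangepoint τ n = j then 1 else 0) = w j n := by
  have h1 : ∀ t ∈ Finset.Icc 1 n, w t n * arrayExpectation w (t - 1)
      (fun τ => if lastChangepoint (insert t τ) n = j then 1 else 0)
      = if t = j then w j n else 0 := by
    intro t ht
    rw [Finset.mem_Icc] at ht
    have := arrayExpectation_congr w (n := t - 1)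
      (F := fun τ => if lastChangepoint (insert t τ) n = j then 1 else 0)
      (G := fun _ => if t = j then 1 else 0)
      (fun τ hτ => by rw [lastChangepoint_insert_of_le ht.2 hτ])
    rw [this]
    split_ifs with h
    · rw [arrayExpectation_one fun i hi => hw i (by simp at hi ⊢; omega), mul_one, h]
    · rw [arrayExpectation_zero, mul_zero]
  rw [arrayExpectation_eq w hn, Finset.sum_congr rfl h1, Finset.sum_ite_eq']
  have h0 : lastChangepoint ∅ n = 0 := rfl
  rw [h0]
  rcases Nat.eq_zero_or_pos j with rfl | hj0
  · simp
  · rw [if_neg (by omega), if_pos (by simp; omega)]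
    ring

/-- Given that a segment ends in `b`, it begins in `j` with probability `w j b`. -/
theorem arrayExpectation_segment {n : ℕ}
    (hw : ∀ i ∈ Finset.Icc 1 n, ∑ j ∈ Finset.range (i + 1), w j i = 1) {j b : ℕ} (hb0 : 1 ≤ b)
    (hb : b ≤ n) (hj : j ≤ b) :
    arrayExpectation w n (fun τ => if lastChangepoint τ b = j ∧ (b = n ∨ b + 1 ∈ τ) then 1 else 0)
      = w j b * arrayExpectation w n fun τ => if b = n ∨ b + 1 ∈ τ then 1 else 0 := by
  induction n using Nat.strong_induction_on with
  | _ n ih =>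
    rcases hb.eq_or_lt with rfl | hbn
    · simp only [true_or, and_true, if_true]
      rw [arrayExpectation_lastChangepoint hw hb0 hj, arrayExpectation_one hw, mul_one]
    · simp only [hbn.ne, false_or] at ih ⊢
      rw [arrayExpectation_eq w (by omega), arrayExpectation_eq w (by omega), mul_add,
        Finset.mul_sum]
      congr 1
      · simp
      · refine Finset.sum_congr rfl fun t ht => ?_
        rw [Finset.mem_Icc] at ht
        rw [mul_left_comm (w j b)]
        congr 1
        have hwt : ∀ i ∈ Finset.Icc 1 (t - 1), ∑ j ∈ Finset.range (i + 1), w j i = 1 :=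
          fun i hi => hw i (by simp at hi ⊢; omega)
        -- Compare the last changepoint `t` with `b + 1`: below it, no segment ends at `b`; at
        -- equality, the rest has final time `b`; above it, the induction hypothesis applies to the
        -- rest.
        rcases lt_trichotomy t (b + 1) with htb | rfl | htb
        · have hnot : ∀ τ ⊆ Finset.Icc 1 (t - 1), b + 1 ∉ insert t τ := by
            intro τ hτ h
            rcases Finset.mem_insert.1 h with h | h
            · omega
            · have := Finset.mem_Icc.1 (hτ h); omega
          rw [arrayExpectation_congr w (G := fun _ => 0) fun τ hτ => by simp only [hnot τ hτ,
              and_false, if_false],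
            arrayExpectation_congr w (F := fun τ => if b + 1 ∈ insert t τ then 1 else 0)
              (G := fun _ => 0) fun τ hτ => by simp only [hnot τ hτ, if_false],
            arrayExpectation_zero, mul_zero]
        · simp only [Finset.mem_insert_self, and_true, if_true, Nat.add_sub_cancel] at hwt ⊢
          simp only [lastChangepoint_insert_of_lt (Nat.lt_succ_self b)]
          rw [arrayExpectation_one hwt, mul_one, arrayExpectation_lastChangepoint hwt hb0 hj]
        · have h := ih (t - 1) (by omega) hwt (by omega)
          simp only [show b ≠ t - 1 by omega, false_or] at h
          simpa only [lastChangepoint_insert_of_lt (by omega : b < t), Finset.mem_insert,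
            show b + 1 ≠ t by omega, false_or] using h

theorem segmentEnd_spec {n i : ℕ} (hi : i ≤ n) (τ : Finset ℕ) :
    i ≤ segmentEnd n τ i ∧ (segmentEnd n τ i = n ∨ segmentEnd n τ i + 1 ∈ τ) :=
  Nat.sInf_mem (s := {e | i ≤ e ∧ (e = n ∨ e + 1 ∈ τ)}) ⟨n, hi, .inl rfl⟩

theorem segmentEnd_le {n τ} {i e : ℕ} (h : i ≤ e) (he : e = n ∨ e + 1 ∈ τ) :
    segmentEnd n τ i ≤ e :=
  Nat.sInf_le ⟨h, he⟩

/-- Exactly one segment of `τ` contains `i`, so a single term survives. -/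
theorem sum_segments_eq {n i : ℕ} (hi : i ≤ n) (τ : Finset ℕ) (g : ℕ → ℕ → ℝ) :
    ∑ b ∈ Finset.Icc i n, ∑ j ∈ Finset.range (i + 1),
      (if lastChangepoint τ b = j ∧ (b = n ∨ b + 1 ∈ τ) then 1 else 0) * g j b
      = g (lastChangepoint τ i) (segmentEnd n τ i) := by
  obtain ⟨h1, h2⟩ := segmentEnd_spec hi τ
  have h3 : ∀ b, i ≤ b → (b = n ∨ b + 1 ∈ τ) → segmentEnd n τ i ≤ b := fun b => segmentEnd_le
  have h4 := h3 n hi (.inl rfl)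
  generalize segmentEnd n τ i = e at *
  -- A changepoint in `(i, e]` would end the segment of `i` before `e`.
  have hlast : lastChangepoint τ e = lastChangepoint τ i := by
    refine lastChangepoint_congr fun t => ⟨fun ⟨ht, hte⟩ => ⟨ht, ?_⟩, fun ⟨ht, hti⟩ => ⟨ht, by omega⟩⟩
    by_contra hti
    have := h3 (t - 1) (by omega) (.inr (by rwa [Nat.sub_add_cancel (by omega)]))
    omega
  have hle := lastChangepoint_le τ i
  rw [Finset.sum_eq_single e, Finset.sum_eq_single (lastChangepoint τ i)]
  · rw [if_pos ⟨hlast, h2⟩, one_mul]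
  · intro j _ hj
    rw [if_neg fun h => hj (h.1.symm.trans hlast), zero_mul]
  · intro h
    exact absurd (Finset.mem_range.2 (by omega)) h
  · intro b hb hbe
    rw [Finset.mem_Icc] at hb
    refine Finset.sum_eq_zero fun j hj => ?_
    rw [Finset.mem_range] at hj
    rw [if_neg, zero_mul]
    rintro ⟨h5, h6⟩
    -- If `b > e`, then `e + 1` is a changepoint at or before `b`, so a segment ending at `b` starts
    -- after `i`.
    have := h3 b hb.1 h6
    have := le_lastChangepoint (i := b) (h2.resolve_left (by omega)) (by omega)
    omega
  · intro h
    exact absurd (Finset.mem_Icc.2 ⟨h1, h4⟩) h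

theorem arrayExpectation_eq_sum_segments {n : ℕ}
    (hw : ∀ i ∈ Finset.Icc 1 n, ∑ j ∈ Finset.range (i + 1), w j i = 1) {i : ℕ} (hi0 : 1 ≤ i)
    (hi : i ≤ n) (g : ℕ → ℕ → ℝ) :
    arrayExpectation w n (fun τ => g (lastChangepoint τ i) (segmentEnd n τ i))
      = ∑ b ∈ Finset.Icc i n, ∑ j ∈ Finset.range (i + 1),
        w j b * (arrayExpectation w n fun τ => if b = n ∨ b + 1 ∈ τ then 1 else 0) * g j b := by
  have : ∀ b ∈ Finset.Icc i n, ∀ j ∈ Finset.range (i + 1),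
      w j b * (arrayExpectation w n fun τ => if b = n ∨ b + 1 ∈ τ then 1 else 0) * g j b
      = ∑ τ ∈ (Finset.Icc 1 n).powerset, arrayWeight w n τ *
        ((if lastChangepoint τ b = j ∧ (b = n ∨ b + 1 ∈ τ) then 1 else 0) * g j b) := by
    intro b hb j hj
    rw [Finset.mem_Icc] at hb
    rw [Finset.mem_range] at hj
    rw [← arrayExpectation_segment hw (by omega) hb.2 (by omega), arrayExpectation, Finset.sum_mul]
    simp only [mul_assoc]
  rw [Finset.sum_congr rfl fun b hb => Finset.sum_congr rfl (this b hb), arrayExpectation]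
  simp only [← sum_segments_eq hi, Finset.mul_sum]
  rw [Finset.sum_comm]
  exact Finset.sum_congr rfl fun b _ => Finset.sum_comm

end Array

end ParticleTable

/-! ### The backward recursion for a sparse table -/

namespace ParticleTable

variable {u : ℕ} (T : ParticleTable u)

/-- The backward recursion for the changepoint probabilities `Q i`. -/
def IsBackwardSolution (Q : ℕ → ℝ) : Prop :=
  Q (T.n + 1) = 1 ∧
    ∀ i ∈ Finset.Icc 1 T.n, Q i = ∑ b ∈ Finset.Icc i T.n, T.entry i b * Q (b + 1)

/-- The weighted sum of the vectors of all segments that contain `i`. -/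
noncomputable def segmentAverage (Q : ℕ → ℝ) (i : ℕ) : Fin u → ℝ :=
  ∑ b ∈ Finset.Icc i T.n, ∑ j ∈ Finset.range (i + 1),
    (T.entry j b * Q (b + 1)) • T.momentEntry j b

variable {T}

theorem IsBackwardSolution.eq {Q Q' : ℕ → ℝ} (h : T.IsBackwardSolution Q)
    (h' : T.IsBackwardSolution Q') {i : ℕ} (hi0 : 1 ≤ i) (hi : i ≤ T.n + 1) : Q i = Q' i := by
  induction hk : T.n + 1 - i using Nat.strong_induction_on generalizing i with
  | _ k ih =>
    rcases hi.eq_or_lt with rfl | hlt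
    · rw [h.1, h'.1]
    · have hm : i ∈ Finset.Icc 1 T.n := by simp; omega
      rw [h.2 i hm, h'.2 i hm]
      refine Finset.sum_congr rfl fun b hb => ?_
      rw [Finset.mem_Icc] at hb
      rw [ih (T.n + 1 - (b + 1)) (by omega) (by omega) (by omega) rfl]

theorem IsBackwardSolution.segmentAverage_eq {Q Q' : ℕ → ℝ} (h : T.IsBackwardSolution Q)
    (h' : T.IsBackwardSolution Q') (i : ℕ) : T.segmentAverage Q i = T.segmentAverage Q' i := by
  refine Finset.sum_congr rfl fun b hb => Finset.sum_congr rfl fun j _ => ?_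
  rw [h.eq h' (by omega) (by simp at hb; omega)]

variable (T)

theorem segmentationWeight_eq (τ : Finset ℕ) :
    T.segmentationWeight τ = arrayWeight T.entry T.n τ := by
  unfold segmentationWeight arrayWeight
  congr!

theorem changepointProb_eq (i : ℕ) :
    T.changepointProb i = arrayExpectation T.entry T.n fun τ => if i ∈ τ then 1 else 0 := by
  simp only [changepointProb, arrayExpectation, segmentationWeight_eq, Finset.sum_filter, mul_ite,
    mul_one, mul_zero]

variable {T}

/-- The segment that contains `i` starts at `i` exactly when `i` is a changepoint. The value at `n +
1` is set by hand, because `changepointProb` vanishes there. -/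
theorem Normalized.isBackwardSolution (h : T.Normalized) :
    T.IsBackwardSolution fun i => if i = T.n + 1 then 1 else T.changepointProb i := by
  refine ⟨if_pos rfl, fun i hi => ?_⟩
  rw [Finset.mem_Icc] at hi
  have h1 := arrayExpectation_eq_sum_segments h hi.1 hi.2 fun j _ => if j = i then 1 else 0
  simp only [lastChangepoint_eq_self_iff hi.1] at h1
  dsimp only
  rw [if_neg (by omega), changepointProb_eq, h1]
  refine Finset.sum_congr rfl fun b hb => ?_
  rw [Finset.mem_Icc] at hb
  simp only [mul_ite, mul_one, mul_zero, Finset.sum_ite_eq', Finset.mem_range, Nat.lt_succ_self,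
    if_true, Nat.add_right_cancel_iff]
  split_ifs with hbn
  · simp only [hbn, true_or, if_true]
    rw [arrayExpectation_one h, mul_one]
  · simp only [hbn, false_or, changepointProb_eq]

theorem Normalized.heightExpectation_eq (h : T.Normalized) {i : ℕ} (hi0 : 1 ≤ i) (hi : i ≤ T.n) :
    T.heightExpectation i
      = T.segmentAverage (fun i => if i = T.n + 1 then 1 else T.changepointProb i) i := by
  funext d
  have h1 := arrayExpectation_eq_sum_segments h hi0 hi fun j b => T.momentEntry j b d
  simp only [heightExpectation, segmentAverage, Finset.sum_apply, Pi.smul_apply, smul_eq_mul]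
  simp only [segmentationWeight_eq]
  refine Eq.trans h1 (Finset.sum_congr rfl fun b hb => Finset.sum_congr rfl fun j _ => ?_)
  congr 2
  simp only [Nat.add_right_cancel_iff]
  split_ifs with hbn
  · simp only [hbn, true_or, if_true]
    exact arrayExpectation_one h
  · simp only [hbn, false_or, changepointProb_eq]

variable (T)

theorem entry_row_col (k : Fin T.size) : T.entry (T.row k) (T.col k) = T.weight k := by
  rw [entry, Finset.sum_eq_single k]
  · simp
  · intro l _ hl
    rw [if_neg]
    rintro ⟨h1, h2⟩
    exact hl (T.injective (Prod.ext h1 h2))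
  · simp

theorem momentEntry_row_col (k : Fin T.size) :
    T.momentEntry (T.row k) (T.col k) = T.moment k := by
  rw [momentEntry, Finset.sum_eq_single k]
  · simp
  · intro l _ hl
    rw [if_neg]
    rintro ⟨h1, h2⟩
    exact hl (T.injective (Prod.ext h1 h2))
  · simp

theorem entry_of_not_present {j i : ℕ} (h : ¬ T.Present j i) : T.entry j i = 0 :=
  Finset.sum_eq_zero fun k _ => if_neg fun hk => h ⟨k, hk⟩

theorem sum_entry_mul (i : ℕ) (s : Finset ℕ) (F : ℕ → ℝ) :
    ∑ b ∈ s, T.entry i b * F b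
      = ∑ k, if T.row k = i ∧ T.col k ∈ s then T.weight k * F (T.col k) else 0 := by
  simp only [entry, Finset.sum_mul]
  rw [Finset.sum_comm]
  refine Finset.sum_congr rfl fun k _ => ?_
  by_cases h : T.row k = i
  · simp [h, ite_mul]
  · simp [h]

/-- Regrouping by stored particles gives the form that a single pass over the list can accumulate.
-/
theorem segmentAverage_apply_eq_sum (Q : ℕ → ℝ) (i : ℕ) (d : Fin u) :
    T.segmentAverage Q i d = ∑ k, if T.row k ≤ i ∧ i ≤ T.col k then
      T.weight k * Q (T.col k + 1) * T.moment k d else 0 := by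
  have h1 : ∀ j b, (T.entry j b * Q (b + 1)) * T.momentEntry j b d
      = ∑ k, if T.row k = j ∧ T.col k = b then
        T.weight k * Q (T.col k + 1) * T.moment k d else 0 := by
    intro j b
    rw [entry, Finset.sum_mul, Finset.sum_mul]
    refine Finset.sum_congr rfl fun k _ => ?_
    split_ifs with hk
    · rw [← hk.1, ← hk.2, momentEntry_row_col]
    · simp
  simp only [segmentAverage, Finset.sum_apply, Pi.smul_apply, smul_eq_mul, h1]
  rw [Finset.sum_congr rfl fun b _ => Finset.sum_comm, Finset.sum_comm]
  refine Finset.sum_congr rfl fun k _ => ?_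
  have := T.col_le k
  by_cases hk : T.row k ≤ i ∧ i ≤ T.col k
  · rw [if_pos hk, Finset.sum_eq_single (T.col k), Finset.sum_eq_single (T.row k)]
    · simp
    · exact fun j _ hj => if_neg fun h => hj h.1.symm
    · intro h; simp at h; omega
    · exact fun b _ hb => Finset.sum_eq_zero fun j _ => if_neg fun h => hb h.2.symm
    · intro h; simp at h; omega
  · rw [if_neg hk]
    refine Finset.sum_eq_zero fun b hb => Finset.sum_eq_zero fun j hj => if_neg fun h => hk ?_
    simp at hb hj
    omega

section Model

variable {T}
variable {𝕏 𝕐 : Type*} [MeasurableSpace 𝕏] [MeasurableSpace 𝕐] {M : ChangepointModel 𝕏 𝕐}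
  {y : ℕ → 𝕐}

theorem Represents.entry_eq (h : T.Represents M y) {j i : ℕ} (hi0 : 1 ≤ i) (hi : i ≤ T.n)
    (hj : j ≤ i) : T.entry j i = M.backward y T.n j i := by
  by_cases hp : T.Present j i
  · obtain ⟨k, rfl, rfl⟩ := hp
    rw [entry_row_col, h.1]
  · rw [T.entry_of_not_present hp, h.2 i (by simp; omega) j hj hp]

/-- Phrasing the solution through `segmentEnds` at `i - 1` covers changepoints at `i ≤ n` and the
boundary value at `n + 1` at once. -/
theorem Represents.isBackwardSolution [StandardBorelSpace 𝕏] (h : T.Represents M y)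
    (hn : 1 ≤ T.n) (hy : M.RegularData y T.n) :
    T.IsBackwardSolution fun i =>
      (M.posterior y T.n).real (ChangepointModel.segmentEnds 𝕏 T.n (i - 1)) := by
  have hprob := M.isProbabilityMeasure_posterior hy hn le_rfl
  refine ⟨?_, fun i hi => ?_⟩
  · simp [ChangepointModel.segmentEnds_self]
  · rw [Finset.mem_Icc] at hi
    have h1 := M.posterior_real_changepoint hy hi.1 hi.2
    dsimp only
    rw [ChangepointModel.segmentEnds_of_lt (by omega), Nat.sub_add_cancel hi.1, h1]
    refine Finset.sum_congr rfl fun b hb => ?_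
    rw [Finset.mem_Icc] at hb
    rw [h.entry_eq (by omega) hb.2 hb.1, Nat.add_sub_cancel]

theorem Represents.integrable_and_integral [StandardBorelSpace 𝕏] (h : T.Represents M y)
    (hy : M.RegularData y T.n) {f : 𝕏 → Fin u → ℝ} (hf : Measurable f)
    (hm : T.RepresentsMoments M y f) {i : ℕ} (hi0 : 1 ≤ i) (hi : i ≤ T.n) :
    Integrable (fun ω => f (ω i).2) (M.posterior y T.n) ∧
      ∫ ω, f (ω i).2 ∂M.posterior y T.n = T.segmentAverage (fun i =>
        (M.posterior y T.n).real (ChangepointModel.segmentEnds 𝕏 T.n (i - 1))) i := by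
  have key : ∀ j b, j ≤ b → 1 ≤ b → b ≤ T.n → M.backward y T.n j b ≠ 0 →
      Integrable f (M.heightLaw y j b) ∧ T.momentEntry j b = ∫ x, f x ∂M.heightLaw y j b := by
    intro j b hj hb0 hb hne
    by_cases hp : T.Present j b
    · obtain ⟨k, rfl, rfl⟩ := hp
      rw [← h.1] at hne
      rw [momentEntry_row_col]
      exact hm k hne
    · exact absurd (h.2 b (by simp; omega) j hj hp) hne
  obtain ⟨h1, h2⟩ := M.integrable_and_integral_height hy hf
    (fun j b hj hb0 hb hne => (key j b hj hb0 hb hne).1) hi0 hi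
  refine ⟨h1, h2.trans (Finset.sum_congr rfl fun b hb => Finset.sum_congr rfl fun j hj => ?_)⟩
  rw [Finset.mem_Icc] at hb
  rw [Finset.mem_range] at hj
  dsimp only
  rw [h.entry_eq (by omega) hb.2 (by omega), Nat.add_sub_cancel]
  -- A vanishing weight hides whatever vector the table carries there.
  by_cases hne : M.backward y T.n j b = 0
  · simp [hne]
  · rw [(key j b (by omega) (by omega) hb.2 hne).2]

end Model

end ParticleTable

/-! ## The program -/

/-- A straight-line program. -/
def RamProg.block : RamInstr → List RamInstr → RamProg
  | c, [] => .instr c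
  | c, c' :: l => .seq (.instr c) (block c' l)

/-- The effect of a list of instructions. -/
noncomputable def RamInstr.applyList {u : ℕ} (T : ParticleTable u) (s : RamState)
    (l : List RamInstr) : RamState :=
  l.foldl (RamInstr.apply T) s

namespace RamExec

variable {u : ℕ} {T : ParticleTable u}

theorem block (c : RamInstr) (l : List RamInstr) (s : RamState) :
    RamExec T (.block c l) s (l.length + 1) (RamInstr.applyList T s (c :: l)) := by
  induction l generalizing c s with
  | nil => exact .instr c s
  | cons c' l ih =>
    rw [List.length_cons, add_comm]
    exact .seq (.instr c s) (ih c' _)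

/-- A loop with loop invariant `I` and loop variant `k`. -/
theorem whileLt_countdown {a b : ℕ} {P : RamProg} {c : ℕ} {I : ℕ → RamState → Prop}
    (hzero : ∀ s, I 0 s → ¬ s.idx a < s.idx b)
    (hstep : ∀ k s, I (k + 1) s → s.idx a < s.idx b ∧ ∃ s', RamExec T P s c s' ∧ I k s')
    (k : ℕ) (s : RamState) (hs : I k s) :
    ∃ s', RamExec T (.whileLt a b P) s (k * (c + 1) + 1) s' ∧ I 0 s' := by
  induction k generalizing s with
  | zero => exact ⟨s, by simpa using .whileFalse (hzero s hs), hs⟩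
  | succ k ih =>
    obtain ⟨hlt, s', hP, hs'⟩ := hstep k s hs
    obtain ⟨s'', hw, hs''⟩ := ih s' hs'
    refine ⟨s'', ?_, hs''⟩
    have := RamExec.whileTrue hlt hP hw
    rwa [show c + (k * (c + 1) + 1) + 1 = (k + 1) * (c + 1) + 1 by ring] at this

end RamExec

namespace ParticleTable

open RamInstr

variable {u : ℕ} (T : ParticleTable u)

/-- The solution of the backward recursion. -/
noncomputable def backwardProb (i : ℕ) : ℝ :=
  if i ≤ T.n then ∑ b ∈ (Finset.Icc i T.n).attach, T.entry i b * backwardProb (b + 1) else 1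
termination_by T.n + 1 - i
decreasing_by
  have := Finset.mem_Icc.1 b.2
  omega

theorem isBackwardSolution_backwardProb : T.IsBackwardSolution T.backwardProb := by
  constructor
  · rw [backwardProb, if_neg (by omega)]
  · intro i hi
    rw [backwardProb, if_pos (Finset.mem_Icc.1 hi).2,
      Finset.sum_attach _ fun b => T.entry i b * T.backwardProb (b + 1)]

/-- The probability of the segment given by the `k`-th particle. -/
noncomputable def segmentProb (k : Fin T.size) : ℝ := T.weight k * T.backwardProb (T.col k + 1)

theorem backwardProb_eq_sum {i : ℕ} (hi0 : 1 ≤ i) (hi : i ≤ T.n) :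
    T.backwardProb i = ∑ k, if T.row k = i then T.segmentProb k else 0 := by
  rw [T.isBackwardSolution_backwardProb.2 i (by simp; omega),
    T.sum_entry_mul i _ fun b => T.backwardProb (b + 1)]
  refine Finset.sum_congr rfl fun k _ => ?_
  have h1 := T.row_le_col k
  have h2 := T.col_le k
  simp only [Finset.mem_Icc, segmentProb]
  congr 1
  apply propext
  constructor
  · exact fun h => h.1
  · rintro rfl
    exact ⟨rfl, h1, h2⟩

/-- Processes the component `d` of the vector of a particle. -/
def momentInstrs (d : ℕ) : List RamInstr :=
  [readMoment 3 0 d, mul 3 3 1, load 4 d 2, add 4 4 3, store d 2 4, load 4 d 5, sub 4 4 3,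
    store d 5 4]

/-- Reads a particle and updates the changepoint probabilities. -/
def particleInstrs (u : ℕ) : List RamInstr :=
  -- Index registers: 0 is the particle counter, 2 the column, 3 the row, 4 the column plus one, 5
  -- the row minus one; 1 stays 0 for the loop tests. Array `u` holds the probabilities, the arrays
  -- `d < u` the differences.
  [idxPred 0, readCol 2 0, readRow 3 0, idxCopy 4 2, idxSucc 4, idxCopy 5 3, idxPred 5, load 1 u 4,
    readWeight 2 0, mul 1 2 1, load 2 u 3, add 2 2 1, store u 3 2]

/-- One step in the computation of the suffix sums of the component `d`. -/
def suffixInstrs (d : ℕ) : List RamInstr :=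
  [load 1 d 2, load 2 d 0, add 1 1 2, store d 0 1]

/-- The cells of the working memory that the program may use. -/
def workspace : Finset (ℕ × ℕ) := Finset.range (u + 1) ×ˢ Finset.range (T.n + 2)

variable {T}

theorem applyList_momentInstrs {k : Fin T.size} (L : List ℕ) (hL : L.Nodup) (hLu : ∀ d ∈ L, d < u)
    (s : RamState) (h0 : s.idx 0 = k) (hused : s.used ⊆ T.workspace)
    (h2 : s.idx 2 < T.n + 2) (h5 : s.idx 5 < T.n + 2) :
    (applyList T s (L.flatMap momentInstrs)).idx = s.idx ∧
    (applyList T s (L.flatMap momentInstrs)).used ⊆ T.workspace ∧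
    (∀ r ∉ L, (applyList T s (L.flatMap momentInstrs)).mem r = s.mem r) ∧
    ∀ d : Fin u, (d : ℕ) ∈ L → ∀ i, (applyList T s (L.flatMap momentInstrs)).mem d i = s.mem d i
      + ((if s.idx 2 = i then s.real 1 * T.moment k d else 0)
        - if s.idx 5 = i then s.real 1 * T.moment k d else 0) := by
  induction L generalizing s with
  | nil => exact ⟨rfl, hused, fun _ _ => rfl, fun d hd => by simp at hd⟩
  | cons e L ih =>
    have he : e < u := hLu e (by simp)
    obtain ⟨heL, hL⟩ := List.nodup_cons.1 hL
    set s₁ := applyList T s (momentInstrs e) with hs₁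
    have h1idx : s₁.idx = s.idx := rfl
    have h1real : s₁.real 1 = s.real 1 := by
      simp [hs₁, applyList, momentInstrs, apply, RamState.setReal, RamState.touch, RamState.setMem]
    have h1mem : ∀ r ≠ e, s₁.mem r = s.mem r := by
      intro r hr
      simp [hs₁, applyList, momentInstrs, apply, RamState.setReal, RamState.touch, RamState.setMem,
        hr]
    have h1e : ∀ i, s₁.mem e i = s.mem e i
        + ((if s.idx 2 = i then s.real 1 * T.moment k ⟨e, he⟩ else 0)
          - if s.idx 5 = i then s.real 1 * T.moment k ⟨e, he⟩ else 0) := by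
      intro i
      by_cases hi2 : s.idx 2 = i <;> by_cases hi5 : s.idx 5 = i <;>
      simp [hs₁, applyList, momentInstrs, apply, RamState.setReal, RamState.touch, RamState.setMem,
        Function.update_apply, h0, he, hi2, hi5, eq_comm (a := i)] <;> ring
    have h1used : s₁.used ⊆ T.workspace := by
      have : s₁.used = insert (e, s.idx 5) (insert (e, s.idx 5) (insert (e, s.idx 2)
        (insert (e, s.idx 2) s.used))) := rfl
      rw [this]
      simp only [Finset.insert_subset_iff, workspace, Finset.mem_product, Finset.mem_range]
      exact ⟨by omega, by omega, by omega, by omega, hused⟩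
    obtain ⟨g1, g2, g3, g4⟩ := ih hL (fun d hd => hLu d (by simp [hd])) s₁ (by rw [h1idx, h0]) h1used
      (by rwa [h1idx]) (by rwa [h1idx])
    have hsplit : applyList T s ((e :: L).flatMap momentInstrs)
        = applyList T s₁ (L.flatMap momentInstrs) := by
      rw [List.flatMap_cons, applyList, List.foldl_append]
      rfl
    rw [hsplit]
    refine ⟨g1.trans h1idx, g2, fun r hr => ?_, fun d hd i => ?_⟩
    · rw [List.mem_cons, not_or] at hr
      rw [g3 r hr.2, h1mem r hr.1]
    · rcases List.mem_cons.1 hd with hd | hd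
      · subst hd
        rw [g3 _ heL, h1e]
      · rw [g4 d hd, h1real, h1idx, h1mem _ fun h => heL (h ▸ hd)]

theorem applyList_suffixInstrs (L : List ℕ) (hL : L.Nodup) (hLu : ∀ d ∈ L, d < u)
    (s : RamState) (hused : s.used ⊆ T.workspace)
    (h0 : s.idx 0 < T.n + 2) (h2 : s.idx 2 < T.n + 2) :
    (applyList T s (L.flatMap suffixInstrs)).idx = s.idx ∧
    (applyList T s (L.flatMap suffixInstrs)).used ⊆ T.workspace ∧
    (∀ r ∉ L, (applyList T s (L.flatMap suffixInstrs)).mem r = s.mem r) ∧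
    ∀ d ∈ L, (applyList T s (L.flatMap suffixInstrs)).mem d
      = Function.update (s.mem d) (s.idx 0) (s.mem d (s.idx 2) + s.mem d (s.idx 0)) := by
  induction L generalizing s with
  | nil => exact ⟨rfl, hused, fun _ _ => rfl, fun d hd => by simp at hd⟩
  | cons e L ih =>
    have he : e < u := hLu e (by simp)
    obtain ⟨heL, hL⟩ := List.nodup_cons.1 hL
    set s₁ := applyList T s (suffixInstrs e) with hs₁
    have h1idx : s₁.idx = s.idx := rfl
    have h1mem : ∀ r ≠ e, s₁.mem r = s.mem r := by
      intro r hr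
      simp [hs₁, applyList, suffixInstrs, apply, RamState.setReal, RamState.touch, RamState.setMem,
        hr]
    have h1e : s₁.mem e
        = Function.update (s.mem e) (s.idx 0) (s.mem e (s.idx 2) + s.mem e (s.idx 0)) := by
      simp [hs₁, applyList, suffixInstrs, apply, RamState.setReal, RamState.touch, RamState.setMem]
    have h1used : s₁.used ⊆ T.workspace := by
      have : s₁.used = insert (e, s.idx 0) (insert (e, s.idx 0) (insert (e, s.idx 2) s.used)) :=
        rfl
      rw [this]
      simp only [Finset.insert_subset_iff, workspace, Finset.mem_product, Finset.mem_range]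
      exact ⟨by omega, by omega, by omega, hused⟩
    obtain ⟨g1, g2, g3, g4⟩ := ih hL (fun d hd => hLu d (by simp [hd])) s₁ h1used
      (by rwa [h1idx]) (by rwa [h1idx])
    have hsplit : applyList T s ((e :: L).flatMap suffixInstrs)
        = applyList T s₁ (L.flatMap suffixInstrs) := by
      rw [List.flatMap_cons, applyList, List.foldl_append]
      rfl
    rw [hsplit]
    refine ⟨g1.trans h1idx, g2, fun r hr => ?_, fun d hd => ?_⟩
    · rw [List.mem_cons, not_or] at hr
      rw [g3 r hr.2, h1mem r hr.1]
    · rcases List.mem_cons.1 hd with rfl | hd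
      · rw [g3 _ heL, h1e]
      · rw [g4 d hd, h1idx, h1mem _ fun h => heL (h ▸ hd)]

theorem applyList_particleInstrs {k : Fin T.size} (s : RamState) (h0 : s.idx 0 = k + 1)
    (hused : s.used ⊆ T.workspace) :
    (applyList T s (particleInstrs u)).idx 0 = k ∧
    (applyList T s (particleInstrs u)).idx 1 = s.idx 1 ∧
    (applyList T s (particleInstrs u)).idx 2 = T.col k ∧
    (applyList T s (particleInstrs u)).idx 5 = T.row k - 1 ∧
    (applyList T s (particleInstrs u)).real 1 = T.weight k * s.mem u (T.col k + 1) ∧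
    (applyList T s (particleInstrs u)).used ⊆ T.workspace ∧
    (∀ r ≠ u, (applyList T s (particleInstrs u)).mem r = s.mem r) ∧
    ∀ i, (applyList T s (particleInstrs u)).mem u i = s.mem u i
      + if T.row k = i then T.weight k * s.mem u (T.col k + 1) else 0 := by
  have h1 := T.row_le_col k
  have h2 := T.col_le k
  refine ⟨?_, ?_, ?_, ?_, ?_, ?_, fun r hr => ?_, fun i => ?_⟩
  all_goals
    simp [applyList, particleInstrs, apply, RamState.setReal, RamState.setIdx, RamState.touch,
      RamState.setMem, h0]
  · simp only [Finset.insert_subset_iff, workspace, Finset.mem_product, Finset.mem_range]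
    exact ⟨by omega, by omega, hused⟩
  · simp [hr]
  · by_cases hi : T.row k = i
    · simp [hi]
    · simp [hi, eq_comm (a := i)]

end ParticleTable

/-! ### Loop invariants and correctness of the program -/

namespace ParticleTable

open RamInstr

variable {u : ℕ} (T : ParticleTable u)

theorem sum_ite_le_eq_add {N : ℕ} (f : Fin N → ℝ) (k : Fin N) :
    ∑ l : Fin N, (if (k : ℕ) ≤ l then f l else 0)
      = ∑ l : Fin N, (if (k : ℕ) + 1 ≤ l then f l else 0) + f k := by
  rw [← Finset.sum_erase_add _ _ (Finset.mem_univ k),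
    ← Finset.sum_erase_add _ _ (Finset.mem_univ k), if_pos le_rfl, if_neg (by omega), add_zero]
  congr 1
  refine Finset.sum_congr rfl fun l hl => ?_
  have : (l : ℕ) ≠ k := fun h => (Finset.mem_erase.1 hl).1 (Fin.ext h)
  congr 1
  apply propext
  omega

/-- The increment of the difference array at `i` that is caused by the `k`-th particle. -/
noncomputable def increment (d : Fin u) (i : ℕ) (k : Fin T.size) : ℝ :=
  (if T.col k = i then T.segmentProb k * T.moment k d else 0)
    - if T.row k - 1 = i then T.segmentProb k * T.moment k d else 0

/-- The invariant of the loop over the particles, when `k` particles remain. -/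
structure ParticleInvariant (k : ℕ) (s : RamState) : Prop where
  idx_zero : s.idx 0 = k
  idx_one : s.idx 1 = 0
  le_size : k ≤ T.size
  used : s.used ⊆ T.workspace
  prob : ∀ i, s.mem u i = (if i = T.n + 1 then 1 else 0)
    + ∑ l : Fin T.size, if k ≤ l then (if T.row l = i then T.segmentProb l else 0) else 0
  diff : ∀ (d : Fin u) (i : ℕ), s.mem d i
    = ∑ l : Fin T.size, if k ≤ l then T.increment d i l else 0

variable {T}

/-- A particle in row `col k + 1` has a column larger than `col k`, hence stands later in the list
and has already been processed. For `col k = n` the cell still holds its initial 1, as no row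
exceeds `n`. -/
theorem ParticleInvariant.mem_col_succ {k : Fin T.size} {s : RamState}
    (h : T.ParticleInvariant (k + 1) s) : s.mem u (T.col k + 1) = T.backwardProb (T.col k + 1) := by
  have h1 := T.col_le k
  rw [h.prob]
  rcases h1.eq_or_lt with hn | hn
  · rw [hn, T.isBackwardSolution_backwardProb.1, if_pos rfl, Finset.sum_eq_zero, add_zero]
    intro l _
    have h2 := T.row_le_col l
    have h3 := T.col_le l
    rw [if_neg (show ¬ T.row l = T.n + 1 by omega), ite_self]
  · rw [if_neg (by omega), zero_add, T.backwardProb_eq_sum (by omega) (by omega)]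
    refine Finset.sum_congr rfl fun l _ => ?_
    by_cases hl : T.row l = T.col k + 1
    · have h2 := T.row_le_col l
      have h3 : k < l := by
        by_contra hlt
        have := T.col_mono (not_lt.1 hlt)
        omega
      rw [if_pos (Nat.succ_le_of_lt h3)]
    · rw [if_neg hl, ite_self]

theorem ParticleInvariant.step {k : ℕ} {s : RamState} (h : T.ParticleInvariant (k + 1) s) :
    T.ParticleInvariant k (applyList T s
      (particleInstrs u ++ (List.range u).flatMap momentInstrs)) := by
  have hk : k < T.size := h.le_size
  lift k to Fin T.size using hk
  have hprob : T.weight k * s.mem u (T.col k + 1) = T.segmentProb k := by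
    rw [h.mem_col_succ, segmentProb]
  have hcol := T.col_le k
  have hrow := T.row_le_col k
  obtain ⟨a0, a1, a2, a5, ar, au, am, amu⟩ := applyList_particleInstrs s h.idx_zero h.used
  rw [applyList, List.foldl_append]
  change T.ParticleInvariant k (applyList T (applyList T s (particleInstrs u)) _)
  generalize applyList T s (particleInstrs u) = s₁ at *
  obtain ⟨b0, b1, b2, b3⟩ := applyList_momentInstrs (List.range u) List.nodup_range
    (fun d hd => List.mem_range.1 hd) s₁ a0 au (by omega) (by omega)
  refine ⟨by rw [b0, a0], by rw [b0, a1, h.idx_one], k.2.le, b1, fun i => ?_, fun d i => ?_⟩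
  · rw [b2 u (by simp), amu, hprob, h.prob, sum_ite_le_eq_add, add_assoc]
  · rw [b3 d (List.mem_range.2 d.2), a2, a5, ar, hprob, am _ d.2.ne, h.diff, sum_ite_le_eq_add]
    rfl

variable (T)

/-- The value of the difference array. -/
noncomputable def difference (d : Fin u) (i : ℕ) : ℝ := ∑ k, T.increment d i k

/-- The invariant of the loop for the suffix sums, when `k` sums remain. -/
structure SuffixInvariant (k : ℕ) (s : RamState) : Prop where
  idx_zero : s.idx 0 = k
  idx_one : s.idx 1 = 0
  le_length : k ≤ T.n
  used : s.used ⊆ T.workspace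
  prob : ∀ i ∈ Finset.Icc 1 T.n, s.mem u i = T.backwardProb i
  todo : ∀ (d : Fin u), ∀ i ≤ k, s.mem d i = T.difference d i
  done : ∀ (d : Fin u) (i : ℕ), k < i → i ≤ T.n + 1 →
    s.mem d i = ∑ b ∈ Finset.Icc i T.n, T.difference d b

variable {T}

/-- Cell `n + 1` thus already holds the empty suffix sum with which the second loop starts. -/
theorem difference_length_succ (d : Fin u) : T.difference d (T.n + 1) = 0 := by
  refine Finset.sum_eq_zero fun k _ => ?_
  have h1 := T.col_le k
  have h2 := T.row_le_col k
  rw [increment, if_neg (by omega), if_neg (by omega), sub_zero]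

theorem ParticleInvariant.suffixInvariant {s : RamState} (h : T.ParticleInvariant 0 s) :
    T.SuffixInvariant T.n (apply T s (readLength 0)) where
  idx_zero := by simp [apply, RamState.setIdx]
  idx_one := by simp [apply, RamState.setIdx, h.idx_one]
  le_length := le_rfl
  used := h.used
  prob i hi := by
    rw [Finset.mem_Icc] at hi
    change s.mem u i = _
    rw [h.prob, if_neg (by omega), T.backwardProb_eq_sum hi.1 hi.2]
    simp
  todo d i _ := by
    change s.mem d i = _
    rw [h.diff]
    simp [difference]
  done d i h1 h2 := by
    obtain rfl : i = T.n + 1 := by omega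
    change s.mem d _ = _
    rw [h.diff]
    simpa [difference] using difference_length_succ d

theorem SuffixInvariant.step {k : ℕ} {s : RamState} (h : T.SuffixInvariant (k + 1) s) :
    T.SuffixInvariant k (applyList T s
      ([idxCopy 2 0, idxSucc 2] ++ (List.range u).flatMap suffixInstrs ++ [idxPred 0])) := by
  have hk := h.le_length
  have hsplit : applyList T s
      ([idxCopy 2 0, idxSucc 2] ++ (List.range u).flatMap suffixInstrs ++ [idxPred 0])
      = apply T (applyList T (applyList T s [idxCopy 2 0, idxSucc 2])
        ((List.range u).flatMap suffixInstrs)) (idxPred 0) := by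
    simp [applyList]
  rw [hsplit]
  have a0 : (applyList T s [idxCopy 2 0, idxSucc 2]).idx 0 = k + 1 := by
    simp [applyList, apply, RamState.setIdx, h.idx_zero]
  have a1 : (applyList T s [idxCopy 2 0, idxSucc 2]).idx 1 = 0 := by
    simp [applyList, apply, RamState.setIdx, h.idx_one]
  have a2 : (applyList T s [idxCopy 2 0, idxSucc 2]).idx 2 = k + 2 := by
    simp [applyList, apply, RamState.setIdx, h.idx_zero]
  have am : (applyList T s [idxCopy 2 0, idxSucc 2]).mem = s.mem := rfl
  have au : (applyList T s [idxCopy 2 0, idxSucc 2]).used ⊆ T.workspace := h.used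
  generalize applyList T s [idxCopy 2 0, idxSucc 2] = s₁ at *
  obtain ⟨b0, b1, b2, b3⟩ := applyList_suffixInstrs (List.range u) List.nodup_range
    (fun d hd => List.mem_range.1 hd) s₁ au (by omega) (by omega)
  generalize applyList T s₁ ((List.range u).flatMap suffixInstrs) = s₂ at *
  have c0 : (apply T s₂ (idxPred 0)).mem = s₂.mem := rfl
  refine ⟨by simp [apply, RamState.setIdx, b0, a0], by simp [apply, RamState.setIdx, b0, a1],
    by omega, b1, fun i hi => ?_, fun d i hi => ?_, fun d i hi hin => ?_⟩
  · rw [c0, b2 u (by simp), am, h.prob i hi]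
  · rw [c0, b3 d (List.mem_range.2 d.2), am, a0, Function.update_of_ne (by omega),
      h.todo d i (by omega)]
  · rw [c0, b3 d (List.mem_range.2 d.2), am, a0, a2]
    rcases (Nat.succ_le_of_lt hi).eq_or_lt with rfl | hlt
    · rw [Nat.succ_eq_add_one, Function.update_self, h.todo d _ le_rfl,
        h.done d (k + 2) (by omega) (by omega), ← Finset.insert_Icc_succ_left_eq_Icc hk,
        Finset.sum_insert (by simp), add_comm]
      rfl
    · rw [Function.update_of_ne (by omega), h.done d i (by omega) hin]

/-- A particle counts if `i ≤ col` and is cancelled if `i ≤ row - 1`, which leaves `row ≤ i ≤ col`.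
Truncation sends rows 0 and 1 both to cell 0, which no sum from `i ≥ 1` meets. -/
theorem sum_difference {i : ℕ} (hi0 : 1 ≤ i) (d : Fin u) :
    ∑ b ∈ Finset.Icc i T.n, T.difference d b = T.segmentAverage T.backwardProb i d := by
  rw [segmentAverage_apply_eq_sum]
  simp only [difference]
  rw [Finset.sum_comm]
  refine Finset.sum_congr rfl fun k _ => ?_
  have h1 := T.col_le k
  have h2 := T.row_le_col k
  simp only [increment, Finset.sum_sub_distrib, Finset.sum_ite_eq, Finset.mem_Icc]
  by_cases hi : i ≤ T.col k
  · rw [if_pos ⟨hi, h1⟩]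
    by_cases hr : T.row k ≤ i
    · rw [if_neg (by omega), if_pos ⟨hr, hi⟩, sub_zero, segmentProb]
    · rw [if_pos (by omega), if_neg (by omega), sub_self]
  · rw [if_neg (by omega), if_neg (by omega), if_neg (by omega), sub_zero]

/-- The program that computes changepoint probabilities and means of heights. -/
def backwardProgram (u : ℕ) : RamProg :=
  .seq (.block (readLength 2) [idxSucc 2, realOne 0, store u 2 0, readSize 0])
    (.seq (.whileLt 1 0 (.block (idxPred 0)
        ((particleInstrs u).tail ++ (List.range u).flatMap momentInstrs)))
      (.seq (.instr (readLength 0))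
        (.whileLt 1 0 (.block (idxCopy 2 0)
          ([idxSucc 2] ++ (List.range u).flatMap suffixInstrs ++ [idxPred 0])))))

theorem runsLinearly_backwardProgram (u : ℕ) :
    ∃ K : ℕ, ∀ T : ParticleTable u, 1 ≤ T.n → T.n ≤ T.size →
      RunsLinearly (backwardProgram u) K T fun s =>
        (∀ i ∈ Finset.Icc 1 T.n, s.mem u i = T.backwardProb i) ∧
        ∀ i ∈ Finset.Icc 1 T.n, ∀ d : Fin u, s.mem d i = T.segmentAverage T.backwardProb i d := by
  set L₁ := (particleInstrs u).tail ++ (List.range u).flatMap momentInstrs with hL₁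
  set L₂ := [idxSucc 2] ++ (List.range u).flatMap suffixInstrs ++ [idxPred 0] with hL₂
  -- A pass through a loop costs `L.length + 1` instructions and one test. The 8 counts five initial
  -- instructions, one `readLength` and two failing tests; `3 * (u + 1)` bounds the workspace, since
  -- `n + 2 ≤ 3 * n`.
  refine ⟨(L₁.length + 2) + (L₂.length + 2) + 8 + 3 * (u + 1), fun T hn hsize => ?_⟩
  have e0 := RamExec.block (T := T) (readLength 2) [idxSucc 2, realOne 0, store u 2 0, readSize 0]
    RamState.init
  have i0 : T.ParticleInvariant T.size (applyList T RamState.init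
      [readLength 2, idxSucc 2, realOne 0, store u 2 0, readSize 0]) := by
    have hnot : ∀ l : Fin T.size, ¬ T.size ≤ l := fun l => by omega
    constructor
    · simp [applyList, apply, RamState.setIdx]
    · rfl
    · exact le_rfl
    · simp [applyList, apply, RamState.setIdx, RamState.setReal, RamState.touch, RamState.setMem,
        RamState.init, workspace]
    · intro i
      simp [applyList, apply, RamState.setIdx, RamState.setReal, RamState.touch, RamState.setMem,
        RamState.init, hnot, Function.update_apply]
    · intro d i
      simp [applyList, apply, RamState.setIdx, RamState.setReal, RamState.touch, RamState.setMem,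
        RamState.init, hnot, d.2.ne]
  obtain ⟨s₁, e1, i1⟩ := RamExec.whileLt_countdown (T := T) (a := 1) (b := 0)
    (P := .block (idxPred 0) L₁) (c := L₁.length + 1) (I := T.ParticleInvariant)
    (fun s h => by rw [h.idx_zero, h.idx_one]; omega)
    (fun k s h => ⟨by rw [h.idx_zero, h.idx_one]; omega, _, RamExec.block _ _ s, h.step⟩) _ _ i0
  obtain ⟨s₂, e2, i2⟩ := RamExec.whileLt_countdown (T := T) (a := 1) (b := 0)
    (P := .block (idxCopy 2 0) L₂) (c := L₂.length + 1) (I := T.SuffixInvariant)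
    (fun s h => by rw [h.idx_zero, h.idx_one]; omega)
    (fun k s h => ⟨by rw [h.idx_zero, h.idx_one]; omega, _, RamExec.block _ _ s, h.step⟩) _ _
    i1.suffixInvariant
  refine ⟨_, s₂, .seq e0 (.seq e1 (.seq (.instr _ _) e2)), ?_, ?_, i2.prob, fun i hi d => ?_⟩
  · have h1 : T.n * (L₂.length + 2) ≤ T.size * (L₂.length + 2) := Nat.mul_le_mul_right _ hsize
    have h2 : 0 ≤ 3 * (u + 1) * T.size := Nat.zero_le _
    simp only [List.length_cons, List.length_nil]
    nlinarith
  · refine (Finset.card_le_card i2.used).trans ?_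
    rw [workspace, Finset.card_product, Finset.card_range, Finset.card_range]
    have h1 : (u + 1) * (T.n + 2) ≤ (u + 1) * (3 * T.n) := Nat.mul_le_mul_left _ (by omega)
    nlinarith
  · rw [Finset.mem_Icc] at hi
    rw [i2.done d i hi.1 (by omega), sum_difference hi.1]

end ParticleTable

theorem mainTheorem1 :
    (∃ (P : RamProg) (K : ℕ), ∀ T : ParticleTable 0, 1 ≤ T.n → T.n ≤ T.size →
      RunsLinearly P K T fun s =>
        (T.Normalized → ∀ i ∈ Finset.Icc 1 T.n, s.mem 0 i = T.changepointProb i) ∧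
        ∀ (𝕏 : Type*) [MeasurableSpace 𝕏] [StandardBorelSpace 𝕏]
          (𝕐 : Type*) [MeasurableSpace 𝕐] [StandardBorelSpace 𝕐]
          (M : ChangepointModel 𝕏 𝕐) (y : ℕ → 𝕐),
          (∀ j i, 0 < j → j ≤ i → i ≤ T.n →
            0 < M.segmentIntegral y j i ∧ M.segmentIntegral y j i < ⊤) →
          T.Represents M y →
          ∀ i ∈ Finset.Icc 1 T.n, s.mem 0 i = (M.posterior y T.n).real {ω | (ω i).1 = i}) ∧
    (∀ u : ℕ, ∃ (P : RamProg) (K : ℕ), ∀ T : ParticleTable u, 1 ≤ T.n → T.n ≤ T.size →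
      RunsLinearly P K T fun s =>
        (T.Normalized → ∀ i ∈ Finset.Icc 1 T.n, ∀ d : Fin u,
          s.mem d i = T.heightExpectation i d) ∧
        ∀ (𝕏 : Type*) [MeasurableSpace 𝕏] [StandardBorelSpace 𝕏]
          (𝕐 : Type*) [MeasurableSpace 𝕐] [StandardBorelSpace 𝕐]
          (M : ChangepointModel 𝕏 𝕐) (y : ℕ → 𝕐) (f : 𝕏 → Fin u → ℝ), Measurable f →
          (∀ j i, 0 < j → j ≤ i → i ≤ T.n →
            0 < M.segmentIntegral y j i ∧ M.segmentIntegral y j i < ⊤) →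
          T.Represents M y → T.RepresentsMoments M y f →
          ∀ i ∈ Finset.Icc 1 T.n,
            Integrable (fun ω => f (ω i).2) (M.posterior y T.n) ∧
            ∀ d : Fin u, s.mem d i = (∫ ω, f (ω i).2 ∂M.posterior y T.n) d) := by
  constructor
  -- With `u = 0` the array of probabilities is array 0 and there are no difference arrays.
  · obtain ⟨K, hK⟩ := ParticleTable.runsLinearly_backwardProgram 0
    refine ⟨ParticleTable.backwardProgram 0, K, fun T hn hsize => ?_⟩
    obtain ⟨t, s, hrun, ht, hused, hQ, -⟩ := hK T hn hsize
    have hsol := T.isBackwardSolution_backwardProb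
    refine ⟨t, s, hrun, ht, hused, fun hT i hi => ?_, ?_⟩
    · rw [hQ i hi]
      rw [Finset.mem_Icc] at hi
      rw [hsol.eq hT.isBackwardSolution hi.1 (by omega), if_neg (by omega)]
    · intro 𝕏 _ _ 𝕐 _ _ M y hy hrep i hi
      rw [hQ i hi]
      rw [Finset.mem_Icc] at hi
      rw [hsol.eq (hrep.isBackwardSolution hn hy) hi.1 (by omega),
        ChangepointModel.segmentEnds_of_lt (by omega), Nat.sub_add_cancel hi.1]
  · intro u
    obtain ⟨K, hK⟩ := ParticleTable.runsLinearly_backwardProgram u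
    refine ⟨ParticleTable.backwardProgram u, K, fun T hn hsize => ?_⟩
    obtain ⟨t, s, hrun, ht, hused, -, hE⟩ := hK T hn hsize
    have hsol := T.isBackwardSolution_backwardProb
    refine ⟨t, s, hrun, ht, hused, fun hT i hi d => ?_, ?_⟩
    · rw [hE i hi d]
      rw [Finset.mem_Icc] at hi
      rw [hsol.segmentAverage_eq hT.isBackwardSolution, hT.heightExpectation_eq hi.1 hi.2]
    · intro 𝕏 _ _ 𝕐 _ _ M y f hf hy hrep hm i hi
      have hi' := Finset.mem_Icc.1 hi
      obtain ⟨h1, h2⟩ := hrep.integrable_and_integral hy hf hm hi'.1 hi'.2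
      refine ⟨h1, fun d => ?_⟩
      rw [hE i hi d, h2, hsol.segmentAverage_eq (hrep.isBackwardSolution hn hy)]
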